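/- **Setting.** Let $\mathcal H_s=\mathbb C^d$ and let $Q_1,\dots,Q_k$ be Hermitian operators on $\mathcal H_s$ (the charges), not necessarily commuting. Let $v_1,\dots,v_k\in\mathbb R$ be values such that $v_j=\operatorname{tr}(\rho\,Q_j)$ for all $j$, for some density operator $\rho>0$ of full rank. For $N\ge 1$ put $\bar Q_j=\frac1N\sum_{\ell=1}^{N}\mathbb 1^{\otimes(\ell-1)}\otimes Q_j\otimes\mathbb 1^{\otimes(N-\ell)}$ on $\mathcal H_s^{\otimes N}$. For a state $\rho$ on $\mathcal H_s^{\otimes N}$ write $\Pr_\rho[|\bar Q_j-v_j|\le\eta]=\operatorname{tr}(\rho\,\Pi)$, where $\Pi$ is the spectral projector of $\bar Q_j$ for the interval $[v_j-\eta,v_j+\eta]$. **Definition.** For tolerances $\varepsilon,\eta,\eta',\delta\ge 0$ and $\delta'>0$, a subspace $\mathcal M\subseteq\mathcal H_s^{\otimes N}$ with orthogonal projector $P$ is an $(\varepsilon,\eta,\eta',\delta,\delta')$-approximate microcanonical subspace for $\{v_j\}$ if 1. every state $\rho$ with support in $\mathcal M$ satisfies $\Pr_\rho[|\bar Q_j-v_j|\le\eta]\ge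 1-\delta$ for all $j$; 2. every state $\rho$ on $\mathcal H_s^{\otimes N}$ with $\Pr_\rho[|\bar Q_j-v_j|\le\eta']\ge 1-\delta'$ for all $j$ satisfies $\operatorname{tr}(P\rho)\ge 1-\varepsilon$. Put $\Omega=P/\operatorname{tr}P$, let $\Omega_\ell$ be the reduced state of $\Omega$ on site $\ell$, and let $D(\rho\|\sigma)=\operatorname{tr}(\rho(\log\rho-\log\sigma))$. **Theorem (the reduced states of an approximate microcanonical state are close to the generalised Gibbs state).** There are $\beta_1,\dots,\beta_k\in\mathbb R$, depending only on $Q$ and $v$, such that the generalised Gibbs state $$\gamma=\frac{e^{-\sum_i\beta_iQ_i}}{\mathcal Z},\qquad \mathcal Z=\operatorname{tr}e^{-\sum_i\beta_iQ_i},$$ satisfies $\operatorname{tr}(\gamma Q_j)=v_j$ for all $j$, and there are constants $K,A$ (depending only on $Q,v$) such that the following holds. (a) For every $\varepsilon\in[0,1)$ there is a constant $C$ (depending only on $Q,v,\varepsilon$) such that for all $N\ge1$, all $\eta,\eta',\delta\ge0$ and $\delta'>0$ with $N\eta'^2\ge K\log(2/\delta')$ (that is, for all $N$ large enough in terms of $\eta',\delta'$),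 and every $(\varepsilon,\eta,\eta',\delta,\delta')$-approximate microcanonical subspace $\mathcal M$ of $\mathcal H_s^{\otimes N}$ for $\{v_j\}$, one has $\mathcal M\ne\{0\}$ and $$\frac1N\sum_{\ell=1}^N D(\Omega_\ell\,\|\,\gamma)\;\le\;\frac{C}{\sqrt N}+A\,(\eta+\delta).$$ (b) Consequently the average relative entropy scales like $1/\sqrt N$ up to the tolerances of $\mathcal M$. Precisely, if for each $N$ a subspace $\mathcal M_N\subseteq\mathcal H_s^{\otimes N}$ is given which for all large $N$ is an $(\varepsilon_N,\eta_N,\eta'_N,\delta_N,\delta'_N)$-approximate microcanonical subspace for $\{v_j\}$, with $\varepsilon_N,\eta_N,\eta_N',\delta_N\ge 0$, $\delta_N'>0$, $\varepsilon_N\le\varepsilon_0<1$, $N\eta_N'^2\ge K\log(2/\delta'_N)$, $\eta_N=O(1/\sqrt N)$ and $\delta_N=O(1/\sqrt N)$, then $$\frac1N\sum_{\ell=1}^N D(\Omega_\ell\,\|\,\gamma)=O\!\left(\frac1{\sqrt N}\right).$$ -/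

import Mathlib

open Filter Asymptotics
open scoped ComplexOrder

noncomputable section

namespace Microcanonical

variable {d k : ℕ}

/-- Index set of the product basis of `(ℂ^d)^{⊗ N}`: the basis vector `e_{f 0} ⊗ ⋯ ⊗ e_{f (N-1)}`
is indexed by `f`. -/
abbrev Conf (d N : ℕ) : Type := Fin N → Fin d

/-- The Hilbert space `(ℂ^d)^{⊗ N}` of `N` copies of the system, in the product basis. -/
abbrev Copies (d N : ℕ) : Type := EuclideanSpace ℂ (Conf d N)

/-- The tensor product `A 0 ⊗ A 1 ⊗ ⋯ ⊗ A (N-1)` of one-site operators. -/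
def tensor {N : ℕ} (A : Fin N → Matrix (Fin d) (Fin d) ℂ) : Matrix (Conf d N) (Conf d N) ℂ :=
  Matrix.of fun f g => ∏ m, A m (f m) (g m)

/-- The operator `1 ⊗ ⋯ ⊗ 1 ⊗ A ⊗ 1 ⊗ ⋯ ⊗ 1`, with `A` acting on site `l`. -/
def siteOp {N : ℕ} (l : Fin N) (A : Matrix (Fin d) (Fin d) ℂ) :
    Matrix (Conf d N) (Conf d N) ℂ :=
  tensor (Function.update (fun _ => 1) l A)

/-- The composite average observable `(1/N) ∑ l, 1 ⊗ ⋯ ⊗ A ⊗ ⋯ ⊗ 1`. -/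
def avgObs (N : ℕ) (A : Matrix (Fin d) (Fin d) ℂ) : Matrix (Conf d N) (Conf d N) ℂ :=
  (N : ℂ)⁻¹ • ∑ l : Fin N, siteOp l A

/-- The reduced state on site `l`: the partial trace over all the other sites. -/
def reduced {N : ℕ} (l : Fin N) (R : Matrix (Conf d N) (Conf d N) ℂ) :
    Matrix (Fin d) (Fin d) ℂ :=
  Matrix.of fun a b => ∑ f : Conf d N with f l = a, R f (Function.update f l b)

/-- Density matrices. -/
def IsState {n : Type*} [Fintype n] (R : Matrix n n ℂ) : Prop :=
  R.PosSemidef ∧ R.trace = 1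

/-- The probability `tr (R Π)` that a measurement of the Hermitian observable `A` in the state `R`
has an outcome in `[v - η, v + η]`; here `Π` is the spectral projector of `A` for this interval. -/
def probNear {n : Type*} [Fintype n] [DecidableEq n] (R A : Matrix n n ℂ) (v η : ℝ) : ℝ :=
  (R * cfc (Set.indicator (Set.Icc (v - η) (v + η)) (fun _ : ℝ => (1 : ℝ))) A).trace.re

/-- The matrix of the orthogonal projector onto a subspace. -/
def projMatrix {n : Type*} [Fintype n] [DecidableEq n] (M : Submodule ℂ (EuclideanSpace ℂ n)) :
    Matrix n n ℂ :=
  Matrix.toEuclideanLin.symm (M.starProjection : EuclideanSpace ℂ n →ₗ[ℂ] EuclideanSpace ℂ n)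

/-- `M` is an approximate microcanonical subspace of `(ℂ^d)^{⊗ N}` for the charges `Q j` and the
values `v j`, with tolerances `ε, η, η', δ, δ'`:
every state with support in `M` gives, for each average charge, an outcome within `η` of `v j` with
probability at least `1 - δ`; every state giving, for each average charge, an outcome within `η'`
of `v j` with probability at least `1 - δ'` has overlap at least `1 - ε` with `M`. -/
def IsApproxMicrocanonical (Q : Fin k → Matrix (Fin d) (Fin d) ℂ) (v : Fin k → ℝ) (N : ℕ)
    (ε η η' δ δ' : ℝ) (M : Submodule ℂ (Copies d N)) : Prop :=
  (∀ R : Matrix (Conf d N) (Conf d N) ℂ, IsState R →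
      LinearMap.range (Matrix.toEuclideanLin R) ≤ M →
      ∀ j, 1 - δ ≤ probNear R (avgObs N (Q j)) (v j) η) ∧
  (∀ R : Matrix (Conf d N) (Conf d N) ℂ, IsState R →
      (∀ j, 1 - δ' ≤ probNear R (avgObs N (Q j)) (v j) η') →
      1 - ε ≤ (projMatrix M * R).trace.re)

/-- The maximally mixed state `P / tr P` on a subspace with projector `P`. -/
def microState {n : Type*} [Fintype n] [DecidableEq n] (M : Submodule ℂ (EuclideanSpace ℂ n)) :
    Matrix n n ℂ :=
  (projMatrix M).trace⁻¹ • projMatrix M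

/-- The operator `exp (-∑ i, β i • Q i)`. -/
def gibbsWeight (Q : Fin k → Matrix (Fin d) (Fin d) ℂ) (β : Fin k → ℝ) :
    Matrix (Fin d) (Fin d) ℂ :=
  NormedSpace.exp (-∑ i, (β i : ℂ) • Q i)

/-- The generalised Gibbs state `exp (-∑ i, β i • Q i) / Z`, with `Z = tr exp (-∑ i, β i • Q i)`. -/
def gibbs (Q : Fin k → Matrix (Fin d) (Fin d) ℂ) (β : Fin k → ℝ) :
    Matrix (Fin d) (Fin d) ℂ :=
  (gibbsWeight Q β).trace⁻¹ • gibbsWeight Q β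

/-- The quantum relative entropy `D(R ‖ S) = tr (R (log R - log S))` of a state `R` with respect to
an invertible state `S` (for which it is finite). The logarithm is taken in the functional calculus;
`Real.log 0 = 0` implements the convention `0 log 0 = 0` for a singular `R`. -/
def relEntropy {n : Type*} [Fintype n] [DecidableEq n] (R S : Matrix n n ℂ) : ℝ :=
  (R * (cfc Real.log R - cfc Real.log S)).trace.re

/-- The average over the sites of the relative entropy of the reduced states of `P / tr P` with
respect to the generalised Gibbs state. -/
def avgRelEntropy (Q : Fin k → Matrix (Fin d) (Fin d) ℂ) (β : Fin k → ℝ) {N : ℕ}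
    (M : Submodule ℂ (Copies d N)) : ℝ :=
  (1 / (N : ℝ)) * ∑ l : Fin N, relEntropy (reduced l (microState M)) (gibbs Q β)

end Microcanonical

end

/-!
The proof compares dimensions. Write `P` for the projector onto the subspace, `r = tr P` and
`γ = exp (-∑ j, β j • Q j) / Z`, with entropy `S = ∑ j, β j * v j + log Z`.

* The multipliers `β` minimise `tr (exp (-∑ j, β j • (Q j - v j)))`. This function is coercive on the
  span of the shifted charges because these have mean zero in a state of full rank
  (`trace_exp_lower_bound`), and the tangent inequality for `tr ∘ exp` (`trace_exp_add_le`) gives the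
  first-order condition `tr (γ (Q j - v j)) = 0` without differentiating the exponential.
* By subadditivity of the entropy (`sum_trace_mul_log_reduced_le`) the sum over the sites of the
  relative entropies is at most `-log r + N (∑ j, β j * E j + log Z)`, where `E j` is the mean of the
  `j`-th average charge in `P / r`. The first property of the subspace makes `E j` differ from `v j`
  by `O(η + δ)` (`abs_trace_mul_avgObs_sub_le`).
* By Hoeffding's inequality (`hoeffding`) the state `γ ⊗ ⋯ ⊗ γ` satisfies the hypothesis of the second
  property of the subspace, so its overlap with `P` is at least `1 - ε`. Most of the weight of this
  state lies on eigenvectors with eigenvalue at most `exp (-N S + O(√N))`, so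
  `log r ≥ N S - O(√N)` (`neg_log_sum_le`).

Adding the estimates, the terms of order `N` cancel. Every quantum quantity is reduced to a finite
sum by choosing a product basis adapted to the operator at hand (`conjDiag`, `diagIn`, `tensor`);
noncommuting charges cause no difficulty, as each one is measured separately.
The order of magnitude in the last assertion also needs the relative entropies to be nonnegative
(`relEntropy_conjDiag_nonneg`).
-/

noncomputable section

namespace Microcanonical

/-! ### Operators diagonal in a given orthonormal basis -/

section DiagonalInBasis

variable {n : Type*} [Fintype n] [DecidableEq n]

/-- The operator with eigenvalue `a i` on the `i`-th column of the unitary matrix `U`. -/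
def conjDiag (U : Matrix n n ℂ) (a : n → ℝ) : Matrix n n ℂ :=
  U * Matrix.diagonal (fun i => (a i : ℂ)) * U.conjTranspose

/-- The `i`-th diagonal entry of `R` in the orthonormal basis formed by the columns of `U`; for a
state `R` this is the outcome distribution of a measurement in that basis. -/
def diagIn (U R : Matrix n n ℂ) (i : n) : ℝ :=
  ((U.conjTranspose * R * U) i i).re

theorem conjTranspose_mul_self_of_mem {U : Matrix n n ℂ} (hU : U ∈ Matrix.unitaryGroup n ℂ) :
    U.conjTranspose * U = 1 :=
  Matrix.mem_unitaryGroup_iff'.1 hU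

theorem mul_conjTranspose_self_of_mem {U : Matrix n n ℂ} (hU : U ∈ Matrix.unitaryGroup n ℂ) :
    U * U.conjTranspose = 1 :=
  Matrix.mem_unitaryGroup_iff.1 hU

theorem exists_eq_conjDiag {A : Matrix n n ℂ} (hA : A.IsHermitian) :
    ∃ U ∈ Matrix.unitaryGroup n ℂ, ∃ a : n → ℝ, A = conjDiag U a :=
  ⟨hA.eigenvectorUnitary, hA.eigenvectorUnitary.2, hA.eigenvalues, hA.spectral_theorem⟩

theorem isHermitian_conjDiag (U : Matrix n n ℂ) (a : n → ℝ) : (conjDiag U a).IsHermitian := by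
  simp only [conjDiag, Matrix.IsHermitian, Matrix.conjTranspose_mul,
    Matrix.conjTranspose_conjTranspose, Matrix.diagonal_conjTranspose, Matrix.mul_assoc]
  congr 3
  ext i
  simp

theorem conjDiag_add (U : Matrix n n ℂ) (a b : n → ℝ) :
    conjDiag U a + conjDiag U b = conjDiag U (fun i => a i + b i) := by
  simp only [conjDiag, ← Matrix.add_mul, ← Matrix.mul_add, Matrix.diagonal_add, Complex.ofReal_add]

theorem smul_conjDiag (U : Matrix n n ℂ) (c : ℝ) (a : n → ℝ) :
    (c : ℂ) • conjDiag U a = conjDiag U (fun i => c * a i) := by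
  have : Matrix.diagonal (fun i => ((c * a i : ℝ) : ℂ)) =
      (c : ℂ) • Matrix.diagonal (fun i => (a i : ℂ)) := by
    rw [← Matrix.diagonal_smul]; congr 1; ext i; simp
  simp only [conjDiag, this, Matrix.mul_smul, Matrix.smul_mul]

theorem conjDiag_sum (U : Matrix n n ℂ) {ι : Type*} (s : Finset ι) (a : ι → n → ℝ) :
    ∑ j ∈ s, conjDiag U (a j) = conjDiag U (fun i => ∑ j ∈ s, a j i) := by
  classical
  induction s using Finset.induction_on with
  | empty => simp [conjDiag]
  | insert j s hj ih => rw [Finset.sum_insert hj, ih, conjDiag_add]; simp [Finset.sum_insert hj]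

theorem conjDiag_one {U : Matrix n n ℂ} (hU : U ∈ Matrix.unitaryGroup n ℂ) :
    conjDiag U (fun _ => 1) = 1 := by
  simp [conjDiag, mul_conjTranspose_self_of_mem hU]

theorem conjDiag_mul {U : Matrix n n ℂ} (hU : U ∈ Matrix.unitaryGroup n ℂ) (a b : n → ℝ) :
    conjDiag U a * conjDiag U b = conjDiag U (fun i => a i * b i) := by
  have : conjDiag U a * conjDiag U b = U * Matrix.diagonal (fun i => (a i : ℂ)) *
      (U.conjTranspose * U) * Matrix.diagonal (fun i => (b i : ℂ)) * U.conjTranspose := by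
    simp only [conjDiag, Matrix.mul_assoc]
  rw [this, conjTranspose_mul_self_of_mem hU, Matrix.mul_one, Matrix.mul_assoc U,
    Matrix.diagonal_mul_diagonal]
  simp [conjDiag]

theorem conjDiag_pow {U : Matrix n n ℂ} (hU : U ∈ Matrix.unitaryGroup n ℂ) (a : n → ℝ) (m : ℕ) :
    conjDiag U a ^ m = conjDiag U (fun i => a i ^ m) := by
  induction m with
  | zero => simp [conjDiag_one hU]
  | succ m ih => simp only [pow_succ, ih, conjDiag_mul hU]

/-- The functional calculus acts on eigenvalues: on the finite set of eigenvalues every function is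
a polynomial. -/
theorem cfc_conjDiag {U : Matrix n n ℂ} (hU : U ∈ Matrix.unitaryGroup n ℂ) (a : n → ℝ)
    (φ : ℝ → ℝ) : cfc φ (conjDiag U a) = conjDiag U (fun i => φ (a i)) := by
  have hH := isHermitian_conjDiag U a
  let S : Finset ℝ := Finset.univ.image a ∪ (Matrix.finite_real_spectrum (A := conjDiag U a)).toFinset
  let q : Polynomial ℝ := Lagrange.interpolate S id φ
  have hq : ∀ x ∈ S, q.eval x = φ x := fun x hx =>
    Lagrange.eval_interpolate_at_node (v := id) φ Function.injective_id.injOn hx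
  have h1 : cfc φ (conjDiag U a) = cfc q.eval (conjDiag U a) :=
    cfc_congr fun x hx => (hq x (by simp [S, hx])).symm
  have h2 : (fun i => φ (a i)) = fun i => q.eval (a i) := by
    ext i; exact (hq _ (by simp [S])).symm
  rw [h1, h2, cfc_polynomial q _ hH.isSelfAdjoint]
  induction q using Polynomial.induction_on' with
  | add p q hp hq => simp [hp, hq, conjDiag_add]
  | monomial m c =>
    rw [Polynomial.aeval_monomial, conjDiag_pow hU, ← Algebra.smul_def]
    simp only [Polynomial.eval_monomial]
    rw [← smul_conjDiag]
    ext i j; simp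

theorem exp_conjDiag {U : Matrix n n ℂ} (hU : U ∈ Matrix.unitaryGroup n ℂ) (a : n → ℝ) :
    NormedSpace.exp (conjDiag U a) = conjDiag U (fun i => Real.exp (a i)) := by
  have hinv : U⁻¹ = U.conjTranspose := Matrix.inv_eq_left_inv (conjTranspose_mul_self_of_mem hU)
  have hunit : IsUnit U := IsUnit.of_mul_eq_one _ (mul_conjTranspose_self_of_mem hU)
  rw [conjDiag, ← hinv, Matrix.exp_conj _ _ hunit, Matrix.exp_diagonal, conjDiag, hinv]
  congr 3
  ext i
  rw [Pi.coe_exp, ← Complex.exp_eq_exp_ℂ, Complex.ofReal_exp]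

theorem trace_mul_conjDiag_re (U R : Matrix n n ℂ) (a : n → ℝ) :
    (R * conjDiag U a).trace.re = ∑ i, diagIn U R i * a i := by
  have : (R * conjDiag U a).trace =
      ((U.conjTranspose * R * U) * Matrix.diagonal (fun i => (a i : ℂ))).trace := by
    rw [conjDiag, ← Matrix.mul_assoc, Matrix.trace_mul_comm]
    simp only [Matrix.mul_assoc]
  rw [this, Matrix.trace, Complex.re_sum]
  refine Finset.sum_congr rfl fun i _ => ?_
  rw [Matrix.diag_apply, Matrix.mul_diagonal]
  simp [diagIn]

theorem diagIn_conjDiag_self {U : Matrix n n ℂ} (hU : U ∈ Matrix.unitaryGroup n ℂ) (a : n → ℝ)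
    (i : n) : diagIn U (conjDiag U a) i = a i := by
  have : U.conjTranspose * conjDiag U a * U = (U.conjTranspose * U) *
      Matrix.diagonal (fun i => (a i : ℂ)) * (U.conjTranspose * U) := by
    simp only [conjDiag, Matrix.mul_assoc]
  rw [diagIn, this, conjTranspose_mul_self_of_mem hU]
  simp

theorem diagIn_one {U : Matrix n n ℂ} (hU : U ∈ Matrix.unitaryGroup n ℂ) (i : n) :
    diagIn U 1 i = 1 := by
  simp [diagIn, conjTranspose_mul_self_of_mem hU]

theorem diagIn_real_smul (U R : Matrix n n ℂ) (c : ℝ) (i : n) :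
    diagIn U ((c : ℂ) • R) i = c * diagIn U R i := by
  simp [diagIn]

theorem diagIn_nonneg {ι : Type*} [Fintype ι] (U : Matrix ι ι ℂ) {R : Matrix ι ι ℂ}
    (hR : R.PosSemidef) (i : ι) :
    0 ≤ diagIn U R i :=
  (Complex.le_def.1 (hR.conjTranspose_mul_mul_same U).diag_nonneg).1

theorem sum_diagIn {U : Matrix n n ℂ} (hU : U ∈ Matrix.unitaryGroup n ℂ) (R : Matrix n n ℂ) :
    ∑ i, diagIn U R i = R.trace.re := by
  simpa [conjDiag_one hU] using (trace_mul_conjDiag_re U R (fun _ => 1)).symm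

theorem sum_diagIn_of_isState {U : Matrix n n ℂ} (hU : U ∈ Matrix.unitaryGroup n ℂ)
    {R : Matrix n n ℂ} (hR : IsState R) : ∑ i, diagIn U R i = 1 := by
  rw [sum_diagIn hU, hR.2, Complex.one_re]

theorem trace_conjDiag {U : Matrix n n ℂ} (hU : U ∈ Matrix.unitaryGroup n ℂ) (a : n → ℝ) :
    (conjDiag U a).trace = ((∑ i, a i : ℝ) : ℂ) := by
  rw [conjDiag, Matrix.trace_mul_comm, ← Matrix.mul_assoc, conjTranspose_mul_self_of_mem hU]
  simp [Matrix.trace]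

theorem posSemidef_conjDiag (U : Matrix n n ℂ) {a : n → ℝ} (ha : ∀ i, 0 ≤ a i) :
    (conjDiag U a).PosSemidef :=
  (Matrix.PosSemidef.diagonal (fun i => by simpa using ha i)).mul_mul_conjTranspose_same U

/-- The weights `s i j` are the squared overlaps of the two bases; being the same for all `a` and `b`,
they reduce a trace inequality for functions of two Hermitian operators to a scalar inequality for
pairs of eigenvalues. -/
theorem exists_overlaps (U W : Matrix n n ℂ) :
    ∃ s : n → n → ℝ, (∀ i j, 0 ≤ s i j) ∧
      (∀ a b : n → ℝ, (conjDiag U a * conjDiag W b).trace.re = ∑ i, ∑ j, s i j * (a i * b j)) := by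
  refine ⟨fun i j => Complex.normSq ((U.conjTranspose * W) i j),
    fun i j => Complex.normSq_nonneg _, fun a b => ?_⟩
  rw [trace_mul_conjDiag_re, Finset.sum_comm]
  refine Finset.sum_congr rfl fun j _ => ?_
  have : W.conjTranspose * conjDiag U a * W = (U.conjTranspose * W).conjTranspose *
      Matrix.diagonal (fun i => (a i : ℂ)) * (U.conjTranspose * W) := by
    simp only [conjDiag, Matrix.mul_assoc, Matrix.conjTranspose_mul,
      Matrix.conjTranspose_conjTranspose]
  rw [diagIn, this, Matrix.mul_apply, Complex.re_sum, Finset.sum_mul]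
  refine Finset.sum_congr rfl fun i _ => ?_
  rw [Matrix.mul_diagonal, Matrix.conjTranspose_apply]
  simp only [Complex.normSq_apply, Complex.mul_re, Complex.mul_im, Complex.ofReal_re,
    Complex.ofReal_im, Complex.star_def, Complex.conj_re, Complex.conj_im]
  ring

end DiagonalInBasis

/-! ### Trace inequalities of Klein's type -/

section Klein

variable {n : Type*} [Fintype n] [DecidableEq n]

theorem trace_mul_eq_ofReal_re {ι : Type*} [Fintype ι] {A B : Matrix ι ι ℂ} (hA : A.IsHermitian) (hB : B.IsHermitian) :
    (A * B).trace = (((A * B).trace.re : ℝ) : ℂ) := by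
  have h : star (A * B).trace = (A * B).trace := by
    rw [← Matrix.trace_conjTranspose, Matrix.conjTranspose_mul, hA.eq, hB.eq, Matrix.trace_mul_comm]
  exact (Complex.conj_eq_iff_re.1 h).symm

theorem isHermitian_exp {A : Matrix n n ℂ} (hA : A.IsHermitian) :
    (NormedSpace.exp A).IsHermitian := by
  obtain ⟨U, hU, a, rfl⟩ := exists_eq_conjDiag hA
  rw [exp_conjDiag hU]
  exact isHermitian_conjDiag _ _

/-- Klein's inequality for the exponential: `A ↦ tr (exp A)` lies above its tangents. -/
theorem trace_exp_add_le {A B : Matrix n n ℂ} (hA : A.IsHermitian) (hB : B.IsHermitian) :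
    (NormedSpace.exp A).trace.re + (NormedSpace.exp A * (B - A)).trace.re ≤
      (NormedSpace.exp B).trace.re := by
  obtain ⟨U, hU, a, rfl⟩ := exists_eq_conjDiag hA
  obtain ⟨W, hW, b, rfl⟩ := exists_eq_conjDiag hB
  obtain ⟨s, hs, h⟩ := exists_overlaps U W
  have h1 := h (fun i => Real.exp (a i)) (fun _ => 1)
  have h2 := h (fun i => Real.exp (a i)) b
  have h3 := h (fun i => Real.exp (a i) * a i) (fun _ => 1)
  have h4 := h (fun _ => 1) (fun j => Real.exp (b j))
  rw [conjDiag_one hW, mul_one] at h1 h3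
  rw [conjDiag_one hU, one_mul] at h4
  rw [exp_conjDiag hU, exp_conjDiag hW, mul_sub, conjDiag_mul hU, Matrix.trace_sub, Complex.sub_re,
    h1, h2, h3, h4, ← sub_nonneg]
  simp only [← Finset.sum_add_distrib, ← Finset.sum_sub_distrib]
  refine Finset.sum_nonneg fun i _ => Finset.sum_nonneg fun j _ => ?_
  have e : Real.exp (b j) = Real.exp (a i) * Real.exp (b j - a i) := by
    rw [← Real.exp_add]; congr 1; ring
  have : 0 ≤ s i j * (Real.exp (a i) * (Real.exp (b j - a i) - (b j - a i + 1))) :=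
    mul_nonneg (hs i j) (mul_nonneg (Real.exp_pos _).le (sub_nonneg.2 (Real.add_one_le_exp _)))
  rw [e]
  linarith

/-- Klein's inequality for the relative entropy, from `x log x - x log y - x + y ≥ 0` for pairs of
eigenvalues. -/
theorem relEntropy_conjDiag_nonneg {U W : Matrix n n ℂ} (hU : U ∈ Matrix.unitaryGroup n ℂ)
    (hW : W ∈ Matrix.unitaryGroup n ℂ) {p q : n → ℝ} (hp : ∀ i, 0 ≤ p i) (hq : ∀ i, 0 < q i)
    (hpq : ∑ i, p i = ∑ i, q i) : 0 ≤ relEntropy (conjDiag U p) (conjDiag W q) := by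
  obtain ⟨s, hs, h⟩ := exists_overlaps U W
  have h1 := h (fun i => p i * Real.log (p i)) (fun _ => 1)
  have h2 := h p (fun j => Real.log (q j))
  have h3 := h p (fun _ => 1)
  have h4 := h (fun _ => 1) q
  rw [conjDiag_one hW, mul_one] at h1 h3
  rw [conjDiag_one hU, one_mul] at h4
  rw [trace_conjDiag hU, Complex.ofReal_re] at h3
  rw [trace_conjDiag hW, Complex.ofReal_re] at h4
  have key : ∑ i, ∑ j, s i j * (p i * Real.log (p i) * 1 - p i * Real.log (q j)
      - p i * 1 + 1 * q j) = relEntropy (conjDiag U p) (conjDiag W q) := by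
    rw [relEntropy, cfc_conjDiag hU, cfc_conjDiag hW, mul_sub, conjDiag_mul hU, Matrix.trace_sub,
      Complex.sub_re, h1, h2]
    simp only [mul_add, mul_sub, Finset.sum_add_distrib, Finset.sum_sub_distrib] at h3 h4 ⊢
    linarith
  rw [← key]
  refine Finset.sum_nonneg fun i _ => Finset.sum_nonneg fun j _ => mul_nonneg (hs i j) ?_
  rcases (hp i).eq_or_lt with h0 | h0
  · simp [← h0, (hq j).le]
  · have := Real.log_le_sub_one_of_pos (div_pos (hq j) h0)
    rw [Real.log_div (hq j).ne' h0.ne'] at this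
    have h5 := mul_le_mul_of_nonneg_left this h0.le
    have h6 : p i * (q j / p i - 1) = q j - p i := by field_simp
    linarith

/-- Coercivity of `H ↦ tr (exp H)` on the Hermitian operators with vanishing mean in a state of
full rank. -/
theorem trace_exp_lower_bound {R : Matrix n n ℂ} (hR : R.PosDef) (htr : R.trace = 1) :
    ∃ c : ℝ, 0 < c ∧ ∀ H : Matrix n n ℂ, H.IsHermitian → (R * H).trace = 0 →
      ∀ i j, c * ‖H i j‖ ≤ (NormedSpace.exp H).trace.re := by
  obtain ⟨U, hU, p, rfl⟩ := exists_eq_conjDiag hR.isHermitian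
  have hp : ∀ i, 0 < p i := fun i => by
    have h1 : IsUnit U := IsUnit.of_mul_eq_one _ (mul_conjTranspose_self_of_mem hU)
    have h2 := (hR.conjTranspose_mul_mul_same (B := U)
      (Matrix.mulVec_injective_of_isUnit h1)).diag_pos (i := i)
    rw [← diagIn_conjDiag_self hU p i]
    exact (Complex.lt_def.1 h2).1
  have hsum : ∑ i, p i = 1 := by
    rw [trace_conjDiag hU] at htr; exact_mod_cast htr
  have hp1 : ∀ i, p i ≤ 1 := fun i =>
    hsum ▸ Finset.single_le_sum (fun j _ => (hp j).le) (Finset.mem_univ i)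
  obtain ⟨c, hc, hcp⟩ : ∃ c : ℝ, 0 < c ∧ ∀ i, c ≤ p i := by
    rcases isEmpty_or_nonempty n with he | he
    · exact ⟨1, one_pos, fun i => he.elim i⟩
    · obtain ⟨i, hi⟩ := Finite.exists_min p
      exact ⟨p i, hp i, hi⟩
  refine ⟨c, hc, fun H hH h0 i j => ?_⟩
  obtain ⟨W, hW, b, rfl⟩ := exists_eq_conjDiag hH
  obtain ⟨s, hs, h⟩ := exists_overlaps U W
  have h1 := h p b
  have h2 := h (fun _ => 1) (fun j => |b j|)
  have h3 := h (fun _ => 1) (fun j => Real.exp (b j))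
  rw [conjDiag_one hU, one_mul, trace_conjDiag hW, Complex.ofReal_re] at h2
  rw [conjDiag_one hU, one_mul] at h3
  rw [h0, Complex.zero_re] at h1
  have hexp : c * ∑ l, |b l| ≤ (NormedSpace.exp (conjDiag W b)).trace.re := by
    suffices hsuff : 0 ≤ (∑ i, ∑ j, s i j * (1 * Real.exp (b j))) -
        c * (∑ i, ∑ j, s i j * (1 * |b j|)) - ∑ i, ∑ j, s i j * (p i * b j) by
      rw [exp_conjDiag hW, h3, h2]; linarith
    simp only [Finset.mul_sum, ← Finset.sum_sub_distrib]
    refine Finset.sum_nonneg fun i _ => Finset.sum_nonneg fun j _ => ?_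
    -- `c |x| + p x ≤ |x| + x ≤ exp x` for `c ≤ p ≤ 1`, weighted by the overlaps.
    have h5 : |b j| + b j ≤ Real.exp (b j) := by
      rcases le_total (b j) 0 with hb | hb
      · rw [abs_of_nonpos hb, neg_add_cancel]; exact (Real.exp_pos _).le
      · rw [abs_of_nonneg hb]
        have := Real.quadratic_le_exp_of_nonneg hb
        nlinarith [sq_nonneg (b j - 1)]
    have h6 : c * |b j| + p i * b j ≤ |b j| + b j := by
      have e1 : 0 ≤ (p i - c) * |b j| := mul_nonneg (sub_nonneg.2 (hcp i)) (abs_nonneg _)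
      have e2 : 0 ≤ (1 - p i) * (|b j| + b j) :=
        mul_nonneg (sub_nonneg.2 (hp1 i)) (by linarith [neg_abs_le (b j), (abs_nonneg (b j))])
      linarith
    have := mul_nonneg (hs i j) (sub_nonneg.2 (h6.trans h5))
    linarith
  refine le_trans (mul_le_mul_of_nonneg_left ?_ hc.le) hexp
  rw [conjDiag, Matrix.mul_apply]
  refine (norm_sum_le _ _).trans (Finset.sum_le_sum fun l _ => ?_)
  rw [Matrix.mul_diagonal, norm_mul, norm_mul, Matrix.conjTranspose_apply, norm_star,
    Complex.norm_real, Real.norm_eq_abs]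
  have e1 := entry_norm_bound_of_unitary hW i l
  have e2 := entry_norm_bound_of_unitary hW j l
  calc ‖W i l‖ * |b l| * ‖W j l‖ ≤ 1 * |b l| * 1 := by gcongr
    _ = |b l| := by ring

end Klein

/-! ### Existence of the generalised Gibbs state -/

section Gibbs

theorem continuous_matrix_exp {n : Type*} [Fintype n] [DecidableEq n] :
    Continuous (fun A : Matrix n n ℂ => NormedSpace.exp A) := by
  let : SeminormedRing (Matrix n n ℂ) := Matrix.linftyOpSemiNormedRing
  let : NormedRing (Matrix n n ℂ) := Matrix.linftyOpNormedRing
  let : NormedAlgebra ℂ (Matrix n n ℂ) := Matrix.linftyOpNormedAlgebra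
  let : NormedAlgebra ℚ (Matrix n n ℂ) := .restrictScalars ℚ ℂ _
  exact NormedSpace.exp_continuous

/-- If the values of finitely many charges are zero in some state of full rank, then `tr (exp H)`
attains its minimum over the real span of the charges. -/
theorem exists_minimizer_trace_exp {d k : ℕ} (X : Fin k → Matrix (Fin d) (Fin d) ℂ)
    (hX : ∀ j, (X j).IsHermitian) {R : Matrix (Fin d) (Fin d) ℂ} (hR : R.PosDef)
    (htr : R.trace = 1) (h0 : ∀ j, (R * X j).trace = 0) :
    ∃ H ∈ Submodule.span ℝ (Set.range X), ∀ H' ∈ Submodule.span ℝ (Set.range X),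
      (NormedSpace.exp H).trace.re ≤ (NormedSpace.exp H').trace.re := by
  obtain ⟨c, hc, hbound⟩ := trace_exp_lower_bound hR htr
  set V := Submodule.span ℝ (Set.range X) with hV
  have hVh : ∀ H ∈ V, H.IsHermitian ∧ (R * H).trace = 0 := fun H hH => by
    induction hH using Submodule.span_induction with
    | mem x hx => obtain ⟨j, rfl⟩ := hx; exact ⟨hX j, h0 j⟩
    | zero => simp
    | add x y _ _ hx hy => exact ⟨hx.1.add hy.1, by rw [mul_add, Matrix.trace_add, hx.2, hy.2, add_zero]⟩
    | smul a x _ hx =>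
      refine ⟨?_, by rw [Matrix.mul_smul, Matrix.trace_smul, hx.2, smul_zero]⟩
      rw [Matrix.IsHermitian, Matrix.conjTranspose_smul, hx.1.eq, star_trivial]
  let f : Matrix (Fin d) (Fin d) ℂ → ℝ := fun H => (NormedSpace.exp H).trace.re
  have hf : Continuous f := Complex.continuous_re.comp continuous_matrix_exp.matrix_trace
  let B : Set (Matrix (Fin d) (Fin d) ℂ) :=
    Set.pi Set.univ fun _ => Set.pi Set.univ fun _ => Metric.closedBall (0 : ℂ) (f 0 / c)
  have hB : IsCompact B :=
    isCompact_univ_pi fun _ => isCompact_univ_pi fun _ => isCompact_closedBall _ _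
  have hVc : IsClosed (V : Set (Matrix (Fin d) (Fin d) ℂ)) :=
    Submodule.closed_of_finiteDimensional V
  have hf0 : 0 ≤ f 0 := by simp [f]
  have h0B : (0 : Matrix (Fin d) (Fin d) ℂ) ∈ B ∩ V := by
    refine ⟨fun i _ j _ => ?_, V.zero_mem⟩
    simpa using div_nonneg hf0 hc.le
  obtain ⟨H, hH, hmin⟩ := (hB.inter_right hVc).exists_isMinOn ⟨0, h0B⟩ hf.continuousOn
  refine ⟨H, hH.2, fun H' hH' => ?_⟩
  by_cases hB' : ∀ i j, ‖H' i j‖ ≤ f 0 / c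
  · exact hmin ⟨fun i _ j _ => mem_closedBall_zero_iff.2 (hB' i j), hH'⟩
  · refine (hmin h0B).trans ?_
    simp only [not_forall, not_le] at hB'
    obtain ⟨i, j, hij⟩ := hB'
    have := hbound H' (hVh H' hH').1 (hVh H' hH').2 i j
    rw [div_lt_iff₀ hc] at hij
    change f 0 ≤ f H'
    change c * ‖H' i j‖ ≤ f H' at this
    linarith

/-- First-order optimality: by the tangent inequality at the displaced points `H + t X`,
`t * tr (exp (H + t X) X)` is nonnegative for all `t`, so `tr (exp H X)` vanishes by continuity. -/
theorem trace_exp_mul_eq_zero_of_min {n : Type*} [Fintype n] [DecidableEq n] {H X : Matrix n n ℂ}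
    (hH : H.IsHermitian) (hX : X.IsHermitian)
    (hmin : ∀ t : ℝ, (NormedSpace.exp H).trace.re ≤ (NormedSpace.exp (H + t • X)).trace.re) :
    (NormedSpace.exp H * X).trace = 0 := by
  have hHt : ∀ t : ℝ, (H + t • X).IsHermitian := fun t => by
    rw [Matrix.IsHermitian, Matrix.conjTranspose_add, Matrix.conjTranspose_smul, hH.eq, hX.eq,
      star_trivial]
  let g : ℝ → ℝ := fun t => (NormedSpace.exp (H + t • X) * X).trace.re
  have hg : Continuous g := by
    refine Complex.continuous_re.comp (Continuous.matrix_trace ?_)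
    refine Continuous.matrix_mul (continuous_matrix_exp.comp ?_) continuous_const
    fun_prop
  have hsign : ∀ t, 0 ≤ t * g t := fun t => by
    have h1 := trace_exp_add_le (hHt t) hH
    have h2 : H - (H + t • X) = -(t • X) := by abel
    rw [h2, mul_neg, Matrix.mul_smul, Matrix.trace_neg, Matrix.trace_smul, Complex.neg_re,
      Complex.real_smul, Complex.re_ofReal_mul] at h1
    have h3 := hmin t
    change 0 ≤ t * (NormedSpace.exp (H + t • X) * X).trace.re
    linarith
  have hpos : 0 ≤ g 0 := by
    refine ge_of_tendsto (hg.tendsto 0 |>.mono_left (nhdsWithin_le_nhds (s := Set.Ioi 0))) ?_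
    filter_upwards [self_mem_nhdsWithin] with t ht
    exact nonneg_of_mul_nonneg_right (hsign t) ht
  have hneg : g 0 ≤ 0 := by
    refine le_of_tendsto (hg.tendsto 0 |>.mono_left (nhdsWithin_le_nhds (s := Set.Iio 0))) ?_
    filter_upwards [self_mem_nhdsWithin] with t ht
    have ht' : t < 0 := ht
    have := hsign t
    by_contra! hlt
    exact absurd this (not_le.2 (mul_neg_of_neg_of_pos ht' hlt))
  rw [trace_mul_eq_ofReal_re (isHermitian_exp hH) hX]
  have : g 0 = 0 := le_antisymm hneg hpos
  simp only [g, zero_smul, add_zero] at this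
  rw [this, Complex.ofReal_zero]

variable {d k : ℕ}

theorem isHermitian_neg_sum_smul {Q : Fin k → Matrix (Fin d) (Fin d) ℂ}
    (hQ : ∀ j, (Q j).IsHermitian) (β : Fin k → ℝ) :
    (-∑ i, (β i : ℂ) • Q i).IsHermitian := by
  rw [Matrix.IsHermitian, Matrix.conjTranspose_neg, Matrix.conjTranspose_sum]
  congr 1
  refine Finset.sum_congr rfl fun i _ => ?_
  rw [Matrix.conjTranspose_smul, (hQ i).eq, Complex.star_def, Complex.conj_ofReal]

theorem gibbs_eq_conjDiag {Q : Fin k → Matrix (Fin d) (Fin d) ℂ} {β : Fin k → ℝ}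
    {W : Matrix (Fin d) (Fin d) ℂ} (hW : W ∈ Matrix.unitaryGroup (Fin d) ℂ) {h : Fin d → ℝ}
    (hh : -∑ i, (β i : ℂ) • Q i = conjDiag W h) :
    gibbs Q β = conjDiag W (fun i => (∑ a, Real.exp (h a))⁻¹ * Real.exp (h i)) := by
  rw [gibbs, gibbsWeight, hh, exp_conjDiag hW, trace_conjDiag hW, ← smul_conjDiag,
    Complex.ofReal_inv]

/-- The shifted charges `Q j - v j` have mean zero in a state of full rank; the generalised Gibbs
state is the normalised exponential at a minimum of `tr (exp H)` over their span. -/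
theorem exists_gibbs {Q : Fin k → Matrix (Fin d) (Fin d) ℂ} (hQ : ∀ j, (Q j).IsHermitian)
    {v : Fin k → ℝ} (hv : ∃ R : Matrix (Fin d) (Fin d) ℂ, R.PosDef ∧ R.trace = 1 ∧
      ∀ j, (R * Q j).trace = (v j : ℂ)) :
    ∃ β : Fin k → ℝ, ∀ j, (gibbs Q β * Q j).trace = (v j : ℂ) := by
  obtain ⟨R, hR, htr, hRv⟩ := hv
  have hd : Nonempty (Fin d) := by
    by_contra he
    rw [not_nonempty_iff] at he
    simp [Matrix.trace] at htr
  let X : Fin k → Matrix (Fin d) (Fin d) ℂ := fun j => Q j - (v j : ℂ) • 1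
  have hX : ∀ j, (X j).IsHermitian := fun j => by
    simp only [X, Matrix.IsHermitian, Matrix.conjTranspose_sub, Matrix.conjTranspose_smul, (hQ j).eq,
      Matrix.conjTranspose_one, Complex.star_def, Complex.conj_ofReal]
  have hRX : ∀ j, (R * X j).trace = 0 := fun j => by
    simp only [X, mul_sub, Matrix.mul_smul, mul_one, Matrix.trace_sub, hRv, Matrix.trace_smul, htr,
      smul_eq_mul, sub_self]
  obtain ⟨H, hH, hmin⟩ := exists_minimizer_trace_exp X hX hR htr hRX
  obtain ⟨γ, hγ⟩ := (Submodule.mem_span_range_iff_exists_fun ℝ).1 hH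
  have hH' : H = -∑ i, ((-γ i : ℝ) : ℂ) • X i := by
    rw [← hγ, ← Finset.sum_neg_distrib]
    refine Finset.sum_congr rfl fun i _ => ?_
    ext a b
    simp
  have hHh : H.IsHermitian := hH' ▸ isHermitian_neg_sum_smul hX _
  have hcrit : ∀ j, (NormedSpace.exp H * X j).trace = 0 := fun j =>
    trace_exp_mul_eq_zero_of_min hHh (hX j) fun t => hmin _
      (Submodule.add_mem _ hH (Submodule.smul_mem _ _ (Submodule.subset_span ⟨j, rfl⟩)))
  refine ⟨fun i => -γ i, fun j => ?_⟩
  -- Passing from `Q i - v i` to `Q i` shifts the exponent by a constant, which the normalisation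
  -- of the Gibbs state absorbs.
  obtain ⟨W, hW, h, hWh⟩ := exists_eq_conjDiag hHh
  have hshift : -∑ i, ((-γ i : ℝ) : ℂ) • Q i = conjDiag W (fun a => h a + ∑ i, γ i * v i) := by
    rw [← conjDiag_add, ← hWh, hH']
    have h1 : conjDiag W (fun _ => ∑ i, γ i * v i) = ((∑ i, γ i * v i : ℝ) : ℂ) • 1 := by
      rw [← conjDiag_one hW, smul_conjDiag]; simp
    rw [h1]
    simp only [X, smul_sub, Finset.sum_sub_distrib, smul_smul, ← Finset.sum_smul]
    push_cast
    simp only [neg_smul, neg_mul, Finset.sum_neg_distrib]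
    abel
  have hc := hcrit j
  rw [hWh, exp_conjDiag hW] at hc
  simp only [X, mul_sub, Matrix.mul_smul, mul_one, Matrix.trace_sub, Matrix.trace_smul,
    trace_conjDiag hW, smul_eq_mul, sub_eq_zero] at hc
  have hsum : 0 < ∑ a, Real.exp (h a) := Finset.sum_pos (fun _ _ => Real.exp_pos _) Finset.univ_nonempty
  have hprob : (fun i => (∑ a, Real.exp (h a + ∑ i, γ i * v i))⁻¹ *
      Real.exp (h i + ∑ i, γ i * v i)) = fun i => (∑ a, Real.exp (h a))⁻¹ * Real.exp (h i) := by
    ext i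
    simp only [Real.exp_add, ← Finset.sum_mul]
    have := Real.exp_pos (∑ i, γ i * v i)
    field_simp
  rw [gibbs_eq_conjDiag hW hshift, hprob, ← smul_conjDiag, Matrix.smul_mul, Matrix.trace_smul, hc,
    smul_eq_mul]
  have : ((∑ a, Real.exp (h a) : ℝ) : ℂ) ≠ 0 := by exact_mod_cast hsum.ne'
  rw [Complex.ofReal_inv]
  field_simp

end Gibbs

/-! ### Product operators, site operators and reduced states -/

section Tensor

variable {d N : ℕ}

theorem tensor_mul_tensor (A B : Fin N → Matrix (Fin d) (Fin d) ℂ) :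
    tensor A * tensor B = tensor fun m => A m * B m := by
  ext f g
  simp only [tensor, Matrix.mul_apply, Matrix.of_apply, ← Finset.prod_mul_distrib]
  exact (Fintype.prod_sum (fun m a => A m (f m) a * B m a (g m))).symm

theorem conjTranspose_tensor (A : Fin N → Matrix (Fin d) (Fin d) ℂ) :
    (tensor A).conjTranspose = tensor fun m => (A m).conjTranspose := by
  ext f g
  simp [tensor, Matrix.conjTranspose_apply]

theorem tensor_diagonal (b : Fin N → Fin d → ℝ) :
    tensor (fun m => Matrix.diagonal fun i => (b m i : ℂ)) =
      Matrix.diagonal fun f : Conf d N => ((∏ m, b m (f m) : ℝ) : ℂ) := by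
  ext f g
  simp only [tensor, Matrix.of_apply, Matrix.diagonal_apply]
  by_cases h : f = g
  · simp [h]
  · obtain ⟨m, hm⟩ := Function.ne_iff.1 h
    rw [if_neg h]
    exact Finset.prod_eq_zero (Finset.mem_univ m) (if_neg hm)

theorem tensor_one : tensor (fun _ : Fin N => (1 : Matrix (Fin d) (Fin d) ℂ)) = 1 := by
  simpa using tensor_diagonal (d := d) (N := N) fun _ _ => 1

theorem tensor_mem_unitaryGroup {U : Fin N → Matrix (Fin d) (Fin d) ℂ}
    (hU : ∀ m, U m ∈ Matrix.unitaryGroup (Fin d) ℂ) :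
    tensor U ∈ Matrix.unitaryGroup (Conf d N) ℂ := by
  rw [Matrix.mem_unitaryGroup_iff, Matrix.star_eq_conjTranspose, conjTranspose_tensor,
    tensor_mul_tensor]
  simp only [mul_conjTranspose_self_of_mem (hU _), tensor_one]

theorem tensor_conjDiag (U : Fin N → Matrix (Fin d) (Fin d) ℂ) (b : Fin N → Fin d → ℝ) :
    tensor (fun m => conjDiag (U m) (b m)) =
      conjDiag (tensor U) fun f => ∏ m, b m (f m) := by
  rw [conjDiag, conjTranspose_tensor, ← tensor_diagonal, tensor_mul_tensor, tensor_mul_tensor]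
  rfl

theorem siteOp_conjDiag {U : Fin N → Matrix (Fin d) (Fin d) ℂ}
    (hU : ∀ m, U m ∈ Matrix.unitaryGroup (Fin d) ℂ) (l : Fin N) (a : Fin d → ℝ) :
    siteOp l (conjDiag (U l) a) = conjDiag (tensor U) fun f => a (f l) := by
  have h : Function.update (fun _ => 1) l (conjDiag (U l) a) =
      fun m => conjDiag (U m) (Function.update (fun _ _ => (1 : ℝ)) l a m) := by
    ext1 m
    rcases eq_or_ne m l with rfl | hm
    · simp
    · simp [Function.update_of_ne hm, conjDiag_one (hU m)]
  rw [siteOp, h, tensor_conjDiag]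
  congr 1
  ext f
  rw [Finset.prod_eq_single l (fun m _ hm => by simp [Function.update_of_ne hm]) (by simp)]
  simp

theorem siteOp_one (l : Fin N) : siteOp l (1 : Matrix (Fin d) (Fin d) ℂ) = 1 := by
  rw [siteOp, Function.update_eq_self_iff.2 rfl, tensor_one]

theorem avgObs_conjDiag {U : Matrix (Fin d) (Fin d) ℂ} (hU : U ∈ Matrix.unitaryGroup (Fin d) ℂ)
    (a : Fin d → ℝ) :
    avgObs N (conjDiag U a) =
      conjDiag (tensor fun _ => U) fun f => (N : ℝ)⁻¹ * ∑ l, a (f l) := by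
  have h : ∀ l : Fin N, siteOp l (conjDiag U a) = conjDiag (tensor fun _ => U) fun f => a (f l) :=
    fun l => siteOp_conjDiag (U := fun _ => U) (fun _ => hU) l a
  rw [avgObs, Finset.sum_congr rfl fun l _ => h l, conjDiag_sum, ← smul_conjDiag]
  simp

theorem siteOp_conjTranspose (l : Fin N) (A : Matrix (Fin d) (Fin d) ℂ) :
    (siteOp l A).conjTranspose = siteOp l A.conjTranspose := by
  rw [siteOp, conjTranspose_tensor, siteOp]
  congr 1
  ext1 m
  rcases eq_or_ne m l with rfl | hm
  · simp
  · simp [Function.update_of_ne hm]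

/-- The defining property of the partial trace: the reduced state on site `l` gives the expectation
values of the operators acting on site `l`. -/
theorem trace_reduced_mul (l : Fin N) (R : Matrix (Conf d N) (Conf d N) ℂ)
    (A : Matrix (Fin d) (Fin d) ℂ) :
    (reduced l R * A).trace = (R * siteOp l A).trace := by
  have hsite : ∀ g f : Conf d N, siteOp l A g f =
      if ∀ m, m ≠ l → g m = f m then A (g l) (f l) else 0 := fun g f => by
    rw [siteOp, tensor, Matrix.of_apply, ← Finset.mul_prod_erase _ _ (Finset.mem_univ l)]
    split_ifs with h
    · rw [Finset.prod_eq_one, mul_one, Function.update_self]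
      intro m hm
      rw [Function.update_of_ne (Finset.ne_of_mem_erase hm), h m (Finset.ne_of_mem_erase hm),
        Matrix.one_apply_eq]
    · push Not at h
      obtain ⟨m, hm, hne⟩ := h
      rw [Finset.prod_eq_zero (Finset.mem_erase.2 ⟨hm, Finset.mem_univ m⟩), mul_zero]
      rw [Function.update_of_ne hm, Matrix.one_apply_ne hne]
  have hright : ∀ f : Conf d N, ∑ g, R f g * siteOp l A g f =
      ∑ b, R f (Function.update f l b) * A b (f l) := fun f => by
    symm
    refine Finset.sum_of_injOn (fun b => Function.update f l b)
      (fun b _ c _ h => by simpa using congrFun h l) (by simp) ?_ ?_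
    · intro g _ hg
      rw [hsite, if_neg, mul_zero]
      intro h
      refine hg ⟨g l, by simp, ?_⟩
      ext1 m
      rcases eq_or_ne m l with rfl | hm
      · simp
      · simp [Function.update_of_ne hm, h m hm]
    · intro b _
      rw [hsite, if_pos fun m hm => Function.update_of_ne hm _ _, Function.update_self]
  simp only [Matrix.trace, Matrix.diag_apply, Matrix.mul_apply, hright]
  simp only [reduced, Matrix.of_apply, Finset.sum_mul]
  rw [← Finset.sum_fiberwise_of_maps_to (g := fun f : Conf d N => f l)
    (fun _ _ => Finset.mem_univ _)]
  refine Finset.sum_congr rfl fun a _ => ?_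
  rw [Finset.sum_comm]
  refine Finset.sum_congr rfl fun f hf => Finset.sum_congr rfl fun b _ => ?_
  rw [(Finset.mem_filter.1 hf).2]

theorem trace_reduced (l : Fin N) (R : Matrix (Conf d N) (Conf d N) ℂ) :
    (reduced l R).trace = R.trace := by
  simpa [siteOp_one] using trace_reduced_mul l R 1

theorem isHermitian_reduced (l : Fin N) {R : Matrix (Conf d N) (Conf d N) ℂ}
    (hR : R.IsHermitian) : (reduced l R).IsHermitian := by
  refine Matrix.ext_iff_trace_mul_right.2 fun A => ?_
  have h : ((reduced l R).conjTranspose * A).trace =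
      star (reduced l R * A.conjTranspose).trace := by
    rw [← Matrix.trace_conjTranspose, Matrix.conjTranspose_mul, Matrix.conjTranspose_conjTranspose,
      Matrix.trace_mul_comm]
  rw [h, trace_reduced_mul, trace_reduced_mul, ← Matrix.trace_conjTranspose,
    Matrix.conjTranspose_mul, siteOp_conjTranspose, Matrix.conjTranspose_conjTranspose, hR.eq,
    Matrix.trace_mul_comm]

/-- The eigenvalues of a reduced state are a marginal of the outcome distribution of the global
state in the product of the local eigenbases. -/
theorem sum_diagIn_tensor {U : Fin N → Matrix (Fin d) (Fin d) ℂ}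
    (hU : ∀ m, U m ∈ Matrix.unitaryGroup (Fin d) ℂ) (l : Fin N)
    (R : Matrix (Conf d N) (Conf d N) ℂ) {p : Fin d → ℝ} (hp : reduced l R = conjDiag (U l) p)
    (φ : Fin d → ℝ) : ∑ f, diagIn (tensor U) R f * φ (f l) = ∑ a, p a * φ a := by
  rw [← trace_mul_conjDiag_re (tensor U) R fun f => φ (f l), ← siteOp_conjDiag hU,
    ← trace_reduced_mul, hp, trace_mul_conjDiag_re]
  simp only [diagIn_conjDiag_self (hU l)]

/-- The reduced states of a state are states, with explicit spectral decompositions. -/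
theorem exists_reduced_eq_conjDiag {R : Matrix (Conf d N) (Conf d N) ℂ} (hR : IsState R) :
    ∃ (U : Fin N → Matrix (Fin d) (Fin d) ℂ) (p : Fin N → Fin d → ℝ),
      (∀ l, U l ∈ Matrix.unitaryGroup (Fin d) ℂ) ∧ (∀ l, reduced l R = conjDiag (U l) (p l)) ∧
      (∀ l a, 0 ≤ p l a) ∧ ∀ l, ∑ a, p l a = 1 := by
  choose U hU p hp using fun l => exists_eq_conjDiag (isHermitian_reduced l hR.1.isHermitian)
  refine ⟨U, p, hU, hp, fun l a => ?_, fun l => ?_⟩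
  · have h := sum_diagIn_tensor hU l R (hp l) (Pi.single a 1)
    rw [Finset.sum_eq_single a (fun b _ hb => by simp [hb]) (by simp), Pi.single_eq_same,
      mul_one] at h
    rw [← h]
    refine Finset.sum_nonneg fun f _ => mul_nonneg (diagIn_nonneg _ hR.1 f) ?_
    rcases eq_or_ne (f l) a with e | e
    · rw [e, Pi.single_eq_same]; exact zero_le_one
    · rw [Pi.single_eq_of_ne e]
  · have h := trace_reduced l R
    rw [hp, trace_conjDiag (hU l), hR.2] at h
    exact_mod_cast h

/-- Subadditivity of the entropy, for a state bounded by `r⁻¹`, whose entropy is at least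
`log r`. -/
theorem sum_trace_mul_log_reduced_le {R : Matrix (Conf d N) (Conf d N) ℂ} (hR : IsState R) {r : ℝ}
    (hr : 0 < r) (hle : ∀ U ∈ Matrix.unitaryGroup (Conf d N) ℂ, ∀ f, r * diagIn U R f ≤ 1) :
    ∑ l, (reduced l R * cfc Real.log (reduced l R)).trace.re ≤ -Real.log r := by
  obtain ⟨U, p, hU, hp, hp0, hp1⟩ := exists_reduced_eq_conjDiag hR
  set q := diagIn (tensor U) R with hq
  have hq0 : ∀ f, 0 ≤ q f := fun f => diagIn_nonneg _ hR.1 f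
  have hq1 : ∑ f, q f = 1 := sum_diagIn_of_isState (tensor_mem_unitaryGroup hU) hR
  have hterm : ∀ l, (reduced l R * cfc Real.log (reduced l R)).trace.re =
      ∑ f, q f * Real.log (p l (f l)) := fun l => by
    rw [sum_diagIn_tensor hU l R (hp l) fun a => Real.log (p l a), hp l, cfc_conjDiag (hU l),
      trace_mul_conjDiag_re]
    simp only [diagIn_conjDiag_self (hU l)]
  have hzero : ∀ f l, p l (f l) = 0 → q f = 0 := fun f l h => by
    have h1 := sum_diagIn_tensor hU l R (hp l) (Pi.single (f l) 1)
    rw [Finset.sum_eq_single (a := f l) (s := Finset.univ) (f := fun a => p l a * _)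
      (fun b _ hb => by simp [hb]) (by simp), h, zero_mul] at h1
    have h2 := (Finset.sum_eq_zero_iff_of_nonneg fun g _ => mul_nonneg (hq0 g) (by
      rcases eq_or_ne (g l) (f l) with e | e
      · rw [e, Pi.single_eq_same]; exact zero_le_one
      · rw [Pi.single_eq_of_ne e])).1 h1 f (Finset.mem_univ f)
    simpa using h2
  -- `log x ≤ x - 1` at `x = r ∏ l, p l (f l)`, averaged over `q`, where `r q ≤ 1`.
  have hpoint : ∀ f, q f * (Real.log r + ∑ l, Real.log (p l (f l))) ≤ ∏ l, p l (f l) - q f :=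
    fun f => by
    by_cases h : ∃ l, p l (f l) = 0
    · obtain ⟨l, hl⟩ := h
      rw [hzero f l hl, zero_mul, sub_zero]
      exact Finset.prod_nonneg fun l _ => hp0 l _
    · push Not at h
      have hpos : 0 < ∏ l, p l (f l) :=
        Finset.prod_pos fun l _ => (hp0 l _).lt_of_ne' (h l)
      rw [← Real.log_prod fun l _ => h l, ← Real.log_mul hr.ne' hpos.ne']
      have h1 := mul_le_mul_of_nonneg_left (Real.log_le_sub_one_of_pos (mul_pos hr hpos)) (hq0 f)
      have h2 := mul_le_mul_of_nonneg_right (hle _ (tensor_mem_unitaryGroup hU) f) hpos.le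
      linarith
  have hsum := Finset.sum_le_sum fun f (_ : f ∈ Finset.univ) => hpoint f
  rw [Finset.sum_sub_distrib, hq1, ← Fintype.prod_sum, Finset.prod_eq_one fun l _ => hp1 l,
    sub_self] at hsum
  simp only [mul_add, Finset.sum_add_distrib, ← Finset.sum_mul, hq1, one_mul,
    Finset.mul_sum] at hsum
  rw [Finset.sum_congr rfl fun l _ => hterm l, Finset.sum_comm]
  linarith

end Tensor

/-! ### Hoeffding bounds for independent samples -/

section ChernoffBound

variable {α : Type*} [Fintype α]

/-- Hoeffding's lemma for a finite distribution. -/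
theorem sum_mul_exp_le {p x : α → ℝ} (hp : ∀ a, 0 ≤ p a) (hp1 : ∑ a, p a = 1) {B : ℝ}
    (hB : 0 < B) (hx : ∀ a, |x a| ≤ B) (hmean : ∑ a, p a * x a = 0) (s : ℝ) :
    ∑ a, p a * Real.exp (s * x a) ≤ Real.exp ((s * B) ^ 2 / 2) := by
  refine le_trans ?_ (Real.cosh_le_exp_half_sq (s * B))
  have h : ∀ a, p a * Real.exp (s * x a) ≤
      Real.cosh (s * B) * p a + B⁻¹ * Real.sinh (s * B) * (p a * x a) := fun a => by
    have hb : |x a / B| ≤ 1 := by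
      rw [abs_div, abs_of_pos hB]; exact (div_le_one hB).2 (hx a)
    have h1 := mul_le_mul_of_nonneg_left (Real.exp_mul_le_cosh_add_mul_sinh hb (s * B)) (hp a)
    have h2 : x a / B * (s * B) = s * x a := by field_simp
    rw [h2] at h1
    refine h1.trans (le_of_eq ?_)
    ring
  refine (Finset.sum_le_sum fun a _ => h a).trans (le_of_eq ?_)
  rw [Finset.sum_add_distrib, ← Finset.mul_sum, ← Finset.mul_sum, hp1, hmean, mul_one, mul_zero,
    add_zero]

/-- Hoeffding's inequality for independent samples of a finite distribution. -/
theorem hoeffding {p x : α → ℝ} (hp : ∀ a, 0 ≤ p a) (hp1 : ∑ a, p a = 1) {B : ℝ}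
    (hB : 0 < B) (hx : ∀ a, |x a| ≤ B) (hmean : ∑ a, p a * x a = 0) (N : ℕ) {t : ℝ} (ht : 0 ≤ t) :
    ∑ f : Fin N → α with N * t ≤ ∑ l, x (f l), ∏ l, p (f l) ≤
      Real.exp (-(N * t ^ 2 / (2 * B ^ 2))) := by
  -- The optimal exponent in the Chernoff bound.
  set s := t / B ^ 2 with hs
  have hs0 : 0 ≤ s := by positivity
  calc ∑ f : Fin N → α with N * t ≤ ∑ l, x (f l), ∏ l, p (f l)
      ≤ ∑ f : Fin N → α, Real.exp (-(s * (N * t))) * ∏ l, p (f l) * Real.exp (s * x (f l)) := by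
        refine (Finset.sum_le_sum fun f hf => ?_).trans
          (Finset.sum_le_univ_sum_of_nonneg fun f => mul_nonneg (Real.exp_pos _).le
            (Finset.prod_nonneg fun l _ => mul_nonneg (hp _) (Real.exp_pos _).le))
        have hf' := mul_le_mul_of_nonneg_left (Finset.mem_filter.1 hf).2 hs0
        rw [Finset.prod_mul_distrib, ← Real.exp_sum, ← Finset.mul_sum, mul_left_comm, ← Real.exp_add]
        refine le_mul_of_one_le_right (Finset.prod_nonneg fun l _ => hp _) (Real.one_le_exp ?_)
        linarith
    _ = Real.exp (-(s * (N * t))) * (∑ a, p a * Real.exp (s * x a)) ^ N := by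
        rw [← Finset.mul_sum, ← Fintype.prod_sum (fun _ a => p a * Real.exp (s * x a)),
          Finset.prod_const, Finset.card_univ, Fintype.card_fin]
    _ ≤ Real.exp (-(s * (N * t))) * Real.exp ((s * B) ^ 2 / 2) ^ N := by
        gcongr
        · exact Finset.sum_nonneg fun a _ => mul_nonneg (hp a) (Real.exp_pos _).le
        · exact sum_mul_exp_le hp hp1 hB hx hmean s
    _ = Real.exp (-(N * t ^ 2 / (2 * B ^ 2))) := by
        rw [← Real.exp_nat_mul, ← Real.exp_add, hs]
        congr 1
        field_simp
        ring

/-- The two-sided form of Hoeffding's inequality, for the closed interval and a distribution with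
mean `v`. -/
theorem one_sub_le_sum_prod_indicator {p a : α → ℝ} (hp : ∀ i, 0 ≤ p i) (hp1 : ∑ i, p i = 1)
    {v B : ℝ} (hB : 0 < B) (ha : ∀ i, |a i - v| ≤ B) (hmean : ∑ i, p i * a i = v) {N : ℕ}
    (hN : 1 ≤ N) {t : ℝ} (ht : 0 ≤ t) :
    1 - 2 * Real.exp (-(N * t ^ 2 / (2 * B ^ 2))) ≤
      ∑ f : Fin N → α, (∏ l, p (f l)) *
        (Set.Icc (v - t) (v + t)).indicator (fun _ => (1 : ℝ)) ((N : ℝ)⁻¹ * ∑ l, a (f l)) := by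
  have hm : ∑ i, p i * (a i - v) = 0 := by
    simp only [mul_sub, Finset.sum_sub_distrib, hmean, ← Finset.sum_mul, hp1, one_mul, sub_self]
  have h1 := hoeffding hp hp1 hB ha hm N ht
  have h2 := hoeffding (x := fun i => -(a i - v)) hp hp1 hB (fun i => by rw [abs_neg]; exact ha i)
    (by simp only [mul_neg, Finset.sum_neg_distrib, hm, neg_zero]) N ht
  have htot : ∑ f : Fin N → α, ∏ l, p (f l) = 1 := by
    rw [← Fintype.prod_sum (fun _ i => p i), hp1, Finset.prod_const_one]
  rw [Finset.sum_filter] at h1 h2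
  have hN' : (0 : ℝ) < N := by exact_mod_cast hN
  suffices h : ∑ f : Fin N → α, ∏ l, p (f l) ≤
      (∑ f : Fin N → α, (∏ l, p (f l)) *
        (Set.Icc (v - t) (v + t)).indicator (fun _ => (1 : ℝ)) ((N : ℝ)⁻¹ * ∑ l, a (f l))) +
      (∑ f : Fin N → α, if N * t ≤ ∑ l, (a (f l) - v) then ∏ l, p (f l) else 0) +
      ∑ f : Fin N → α, if N * t ≤ ∑ l, -(a (f l) - v) then ∏ l, p (f l) else 0 by
    rw [htot] at h
    linarith
  simp only [← Finset.sum_add_distrib]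
  refine Finset.sum_le_sum fun f _ => ?_
  have hf : 0 ≤ ∏ l, p (f l) := Finset.prod_nonneg fun l _ => hp _
  have e : ∑ l, (a (f l) - v) = N * ((N : ℝ)⁻¹ * ∑ l, a (f l) - v) := by
    rw [Finset.sum_sub_distrib, Finset.sum_const, Finset.card_univ, Fintype.card_fin, nsmul_eq_mul]
    field_simp
  rw [Finset.sum_neg_distrib, e, ← mul_neg]
  simp only [mul_le_mul_iff_right₀ hN']
  set y := (N : ℝ)⁻¹ * ∑ l, a (f l)
  by_cases hy : y ∈ Set.Icc (v - t) (v + t)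
  · rw [Set.indicator_of_mem hy, mul_one]
    split_ifs <;> linarith
  · rw [Set.indicator_of_notMem hy, mul_zero]
    rw [Set.mem_Icc, not_and_or, not_le, not_le] at hy
    rcases hy with hy | hy
    · rw [if_pos (show t ≤ -(y - v) by linarith)]
      split_ifs <;> linarith
    · rw [if_pos (show t ≤ y - v by linarith)]
      split_ifs <;> linarith

/-- A test `w` of size at least `1 - ε` for `N` independent samples of `g` contains almost
`exp (N S)` points, where `S` is the entropy of `g`: up to an event of probability `(1 - ε) / 2`,
the samples have probability at most `exp (-N S + O(√N))`. -/
theorem neg_log_sum_le {g : α → ℝ} (hg : ∀ a, 0 < g a) (hg1 : ∑ a, g a = 1) {S B : ℝ}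
    (hS : ∑ a, g a * Real.log (g a) = -S) (hB : 0 < B) (hx : ∀ a, |Real.log (g a) + S| ≤ B)
    {ε : ℝ} (hε0 : 0 ≤ ε) (hε : ε < 1) {N : ℕ} (hN : 1 ≤ N) {w : (Fin N → α) → ℝ}
    (hw0 : ∀ f, 0 ≤ w f) (hw1 : ∀ f, w f ≤ 1) (hw : 1 - ε ≤ ∑ f, w f * ∏ l, g (f l)) :
    0 < ∑ f, w f ∧ -Real.log (∑ f, w f) ≤
      √N * (B * √(2 * Real.log (2 / (1 - ε)))) + Real.log (2 / (1 - ε)) - N * S := by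
  have hε' : 0 < 1 - ε := sub_pos.2 hε
  set L := Real.log (2 / (1 - ε)) with hL
  have hL0 : 0 ≤ L := Real.log_nonneg ((one_le_div hε').2 (by linarith))
  have hN' : (0 : ℝ) < N := by exact_mod_cast hN
  -- The deviation `t` for which Hoeffding's bound equals `(1 - ε) / 2`.
  set t := B * √(2 * L) / √N with ht
  have ht0 : 0 ≤ t := by positivity
  have hNt : N * t = √N * (B * √(2 * L)) := by
    have hs := Real.mul_self_sqrt hN'.le
    have hs0 := Real.sqrt_pos.2 hN'
    rw [ht, ← mul_div_assoc, div_eq_iff hs0.ne']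
    linear_combination -(B * √(2 * L)) * hs
  have hexp : Real.exp (-(N * t ^ 2 / (2 * B ^ 2))) = (1 - ε) / 2 := by
    have h1 : N * t ^ 2 / (2 * B ^ 2) = L := by
      rw [ht, div_pow, mul_pow, Real.sq_sqrt (by positivity), Real.sq_sqrt hN'.le]
      field_simp
    rw [h1, ← Real.log_inv, Real.exp_log (by positivity), inv_div]
  have htail := hoeffding (fun a => (hg a).le) hg1 hB hx (by
    simp only [mul_add, Finset.sum_add_distrib, hS, ← Finset.sum_mul, hg1]; ring) N ht0
  rw [hexp, Finset.sum_filter] at htail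
  have hpoint : ∀ f : Fin N → α, w f * ∏ l, g (f l) ≤ w f * Real.exp (N * t - N * S) +
      if N * t ≤ ∑ l, (Real.log (g (f l)) + S) then ∏ l, g (f l) else 0 := fun f => by
    have hprod : 0 ≤ ∏ l, g (f l) := Finset.prod_nonneg fun l _ => (hg _).le
    split_ifs with h
    · have h1 := mul_le_mul_of_nonneg_right (hw1 f) hprod
      have h2 := mul_nonneg (hw0 f) (Real.exp_pos (N * t - N * S)).le
      linarith
    · rw [add_zero]
      refine mul_le_mul_of_nonneg_left ?_ (hw0 f)
      rw [not_le, Finset.sum_add_distrib, Finset.sum_const, Finset.card_univ, Fintype.card_fin,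
        nsmul_eq_mul] at h
      have h1 : ∏ l, g (f l) = Real.exp (∑ l, Real.log (g (f l))) := by
        rw [Real.exp_sum]
        exact Finset.prod_congr rfl fun l _ => (Real.exp_log (hg _)).symm
      rw [h1, Real.exp_le_exp]
      linarith
  have hsum := hw.trans (Finset.sum_le_sum fun f _ => hpoint f)
  rw [Finset.sum_add_distrib, ← Finset.sum_mul] at hsum
  have hmain : (1 - ε) / 2 ≤ (∑ f, w f) * Real.exp (N * t - N * S) := by linarith
  have hpos : 0 < ∑ f, w f :=
    pos_of_mul_pos_left (lt_of_lt_of_le (by positivity) hmain) (Real.exp_pos _).le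
  refine ⟨hpos, ?_⟩
  have hlog := Real.log_le_log (by positivity) hmain
  rw [Real.log_mul hpos.ne' (Real.exp_pos _).ne', Real.log_exp, ← inv_div, Real.log_inv, ← hL,
    hNt] at hlog
  linarith

end ChernoffBound

/-! ### Projectors and maximally mixed states -/

section Projector

variable {n : Type*} [Fintype n] [DecidableEq n]

theorem isHermitian_projMatrix (M : Submodule ℂ (EuclideanSpace ℂ n)) :
    (projMatrix M).IsHermitian := by
  rw [← Matrix.isSymmetric_toEuclideanLin_iff, projMatrix, LinearEquiv.apply_symm_apply]
  exact M.starProjection_isSymmetric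

theorem projMatrix_mul_self (M : Submodule ℂ (EuclideanSpace ℂ n)) :
    projMatrix M * projMatrix M = projMatrix M := by
  apply Matrix.toEuclideanLin.injective
  rw [Matrix.toLpLin_mul_same, projMatrix, LinearEquiv.apply_symm_apply]
  exact congrArg ContinuousLinearMap.toLinearMap M.isIdempotentElem_starProjection

theorem posSemidef_projMatrix (M : Submodule ℂ (EuclideanSpace ℂ n)) :
    (projMatrix M).PosSemidef := by
  have h := Matrix.posSemidef_conjTranspose_mul_self (projMatrix M)
  rwa [(isHermitian_projMatrix M).eq, projMatrix_mul_self] at h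

theorem diagIn_projMatrix_le_one {U : Matrix n n ℂ} (hU : U ∈ Matrix.unitaryGroup n ℂ)
    (M : Submodule ℂ (EuclideanSpace ℂ n)) (i : n) : diagIn U (projMatrix M) i ≤ 1 := by
  have h := Matrix.posSemidef_conjTranspose_mul_self (1 - projMatrix M)
  rw [Matrix.conjTranspose_sub, (isHermitian_projMatrix M).eq, Matrix.conjTranspose_one, mul_sub,
    sub_mul, sub_mul, projMatrix_mul_self] at h
  simp only [mul_one, one_mul, sub_self, sub_zero] at h
  have h1 := diagIn_nonneg U h i
  rw [diagIn, mul_sub, sub_mul, Matrix.sub_apply, Complex.sub_re] at h1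
  have h2 := diagIn_one hU i
  rw [diagIn] at h2
  rw [diagIn]
  linarith

theorem trace_projMatrix (M : Submodule ℂ (EuclideanSpace ℂ n)) :
    (projMatrix M).trace = (((projMatrix M).trace.re : ℝ) : ℂ) := by
  have h := trace_mul_eq_ofReal_re (isHermitian_projMatrix M) (isHermitian_projMatrix M)
  rwa [projMatrix_mul_self] at h

theorem ne_bot_of_trace_projMatrix_pos {M : Submodule ℂ (EuclideanSpace ℂ n)}
    (hM : 0 < (projMatrix M).trace.re) : M ≠ ⊥ := by
  rintro rfl
  simp [projMatrix] at hM

theorem microState_eq (M : Submodule ℂ (EuclideanSpace ℂ n)) :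
    microState M = (((projMatrix M).trace.re⁻¹ : ℝ) : ℂ) • projMatrix M := by
  rw [microState, trace_projMatrix, Complex.ofReal_re, Complex.ofReal_inv]

theorem isState_microState {M : Submodule ℂ (EuclideanSpace ℂ n)}
    (hM : 0 < (projMatrix M).trace.re) : IsState (microState M) := by
  rw [microState_eq]
  refine ⟨(posSemidef_projMatrix M).smul (by exact_mod_cast (inv_pos.2 hM).le), ?_⟩
  rw [Matrix.trace_smul, trace_projMatrix, Complex.ofReal_re, smul_eq_mul, ← Complex.ofReal_mul,
    inv_mul_cancel₀ hM.ne', Complex.ofReal_one]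

theorem range_microState_le (M : Submodule ℂ (EuclideanSpace ℂ n)) :
    LinearMap.range (Matrix.toEuclideanLin (microState M)) ≤ M := by
  rintro _ ⟨x, rfl⟩
  rw [microState, map_smul, projMatrix, LinearEquiv.apply_symm_apply]
  exact M.smul_mem _ (M.starProjection_apply_mem x)

theorem trace_mul_diagIn_microState_le_one {M : Submodule ℂ (EuclideanSpace ℂ n)}
    (hM : 0 < (projMatrix M).trace.re) {U : Matrix n n ℂ} (hU : U ∈ Matrix.unitaryGroup n ℂ)
    (i : n) : (projMatrix M).trace.re * diagIn U (microState M) i ≤ 1 := by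
  rw [microState_eq, diagIn_real_smul, mul_inv_cancel_left₀ hM.ne']
  exact diagIn_projMatrix_le_one hU M i

end Projector

/-! ### Outcome statistics of the average charges -/

section Statistics

variable {d N : ℕ}

theorem diagIn_tensor (U : Fin N → Matrix (Fin d) (Fin d) ℂ)
    {R : Fin N → Matrix (Fin d) (Fin d) ℂ} (hR : ∀ l, (R l).IsHermitian) (f : Conf d N) :
    diagIn (tensor U) (tensor R) f = ∏ l, diagIn (U l) (R l) (f l) := by
  have h : ∀ l, ((U l).conjTranspose * R l * U l) (f l) (f l) = (diagIn (U l) (R l) (f l) : ℂ) :=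
    fun l => ((Matrix.isHermitian_conjTranspose_mul_mul (U l) (hR l)).coe_re_apply_self (f l)).symm
  rw [diagIn, conjTranspose_tensor, tensor_mul_tensor, tensor_mul_tensor, tensor, Matrix.of_apply,
    Finset.prod_congr rfl fun l _ => h l, ← Complex.ofReal_prod, Complex.ofReal_re]

theorem probNear_avgObs_conjDiag {U : Matrix (Fin d) (Fin d) ℂ}
    (hU : U ∈ Matrix.unitaryGroup (Fin d) ℂ) (a : Fin d → ℝ) (R : Matrix (Conf d N) (Conf d N) ℂ)
    (v η : ℝ) :
    probNear R (avgObs N (conjDiag U a)) v η = ∑ f, diagIn (tensor fun _ => U) R f *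
      (Set.Icc (v - η) (v + η)).indicator (fun _ => (1 : ℝ)) ((N : ℝ)⁻¹ * ∑ l, a (f l)) := by
  rw [probNear, avgObs_conjDiag hU, cfc_conjDiag (tensor_mem_unitaryGroup fun _ => hU),
    trace_mul_conjDiag_re]

/-- The law of large numbers for the average charge in a product state. -/
theorem one_sub_le_probNear_tensor {A γ : Matrix (Fin d) (Fin d) ℂ}
    {U : Matrix (Fin d) (Fin d) ℂ} (hU : U ∈ Matrix.unitaryGroup (Fin d) ℂ) {a : Fin d → ℝ}
    (hA : A = conjDiag U a) (hγ : IsState γ) {v B : ℝ} (hB : 0 < B) (ha : ∀ i, |a i - v| ≤ B)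
    (hmean : (γ * A).trace = (v : ℂ)) (hN : 1 ≤ N) {t : ℝ} (ht : 0 ≤ t) :
    1 - 2 * Real.exp (-(N * t ^ 2 / (2 * B ^ 2))) ≤
      probNear (tensor fun _ : Fin N => γ) (avgObs N A) v t := by
  subst hA
  rw [probNear_avgObs_conjDiag hU]
  simp only [diagIn_tensor _ fun _ => hγ.1.isHermitian]
  refine one_sub_le_sum_prod_indicator (fun i => diagIn_nonneg U hγ.1 i)
    (sum_diagIn_of_isState hU hγ) hB ha ?_ hN ht
  rw [← trace_mul_conjDiag_re, hmean, Complex.ofReal_re]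

/-- If the average charge is close to `v` with high probability, then so is its mean. -/
theorem abs_trace_mul_avgObs_sub_le {A U : Matrix (Fin d) (Fin d) ℂ}
    (hU : U ∈ Matrix.unitaryGroup (Fin d) ℂ) {a : Fin d → ℝ} (hA : A = conjDiag U a)
    {R : Matrix (Conf d N) (Conf d N) ℂ} (hR : IsState R) {v B η δ : ℝ} (ha : ∀ i, |a i - v| ≤ B)
    (hB : 0 ≤ B) (hN : 1 ≤ N) (hη : 0 ≤ η) (hprob : 1 - δ ≤ probNear R (avgObs N A) v η) :
    |(R * avgObs N A).trace.re - v| ≤ η + B * δ := by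
  subst hA
  have hV := tensor_mem_unitaryGroup (N := N) fun _ => hU
  rw [probNear_avgObs_conjDiag hU] at hprob
  rw [avgObs_conjDiag hU, trace_mul_conjDiag_re]
  set q := diagIn (tensor fun _ => U) R
  have hq0 : ∀ f, 0 ≤ q f := fun f => diagIn_nonneg _ hR.1 f
  have hq1 : ∑ f, q f = 1 := sum_diagIn_of_isState hV hR
  have hN' : (0 : ℝ) < N := by exact_mod_cast hN
  have hpoint : ∀ f : Conf d N, |(N : ℝ)⁻¹ * ∑ l, a (f l) - v| ≤ η + B * (1 -
      (Set.Icc (v - η) (v + η)).indicator (fun _ => (1 : ℝ)) ((N : ℝ)⁻¹ * ∑ l, a (f l))) :=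
    fun f => by
    by_cases h : (N : ℝ)⁻¹ * ∑ l, a (f l) ∈ Set.Icc (v - η) (v + η)
    · rw [Set.indicator_of_mem h, sub_self, mul_zero, add_zero, abs_le]
      exact ⟨by linarith [h.1], by linarith [h.2]⟩
    · rw [Set.indicator_of_notMem h, sub_zero, mul_one]
      have e : (N : ℝ)⁻¹ * ∑ l, a (f l) - v = (N : ℝ)⁻¹ * ∑ l, (a (f l) - v) := by
        rw [Finset.sum_sub_distrib, Finset.sum_const, Finset.card_univ, Fintype.card_fin,
          nsmul_eq_mul]
        field_simp
      have h1 : |∑ l, (a (f l) - v)| ≤ N * B := by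
        refine (Finset.abs_sum_le_sum_abs _ _).trans ?_
        refine (Finset.sum_le_sum fun l _ => ha (f l)).trans (le_of_eq ?_)
        rw [Finset.sum_const, Finset.card_univ, Fintype.card_fin, nsmul_eq_mul]
      have h2 : |(N : ℝ)⁻¹ * ∑ l, (a (f l) - v)| ≤ B := by
        rw [abs_mul, abs_of_pos (inv_pos.2 hN'), inv_mul_le_iff₀ hN']
        exact h1
      rw [e]
      linarith
  have hv : v = ∑ f, q f * v := by rw [← Finset.sum_mul, hq1, one_mul]
  conv_lhs => rw [hv]
  rw [← Finset.sum_sub_distrib]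
  refine (Finset.abs_sum_le_sum_abs _ _).trans ?_
  have h1 : ∀ f, |q f * ((N : ℝ)⁻¹ * ∑ l, a (f l)) - q f * v| ≤
      (η + B) * q f - B * (q f * (Set.Icc (v - η) (v + η)).indicator (fun _ => (1 : ℝ))
        ((N : ℝ)⁻¹ * ∑ l, a (f l))) := fun f => by
    rw [← mul_sub, abs_mul, abs_of_nonneg (hq0 f)]
    refine (mul_le_mul_of_nonneg_left (hpoint f) (hq0 f)).trans (le_of_eq ?_)
    ring
  refine (Finset.sum_le_sum fun f _ => h1 f).trans ?_
  rw [Finset.sum_sub_distrib, ← Finset.mul_sum, ← Finset.mul_sum, hq1]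
  have := mul_le_mul_of_nonneg_left hprob hB
  linarith

end Statistics

/-! ### The relative entropy to the generalised Gibbs state -/

section RelativeEntropy

variable {d k N : ℕ}

/-- The spectral decomposition of the generalised Gibbs state, whose logarithm is
`-∑ j, β j • Q j - log Z`. -/
theorem exists_gibbs_spectral {Q : Fin k → Matrix (Fin d) (Fin d) ℂ}
    (hQ : ∀ j, (Q j).IsHermitian) (β : Fin k → ℝ) (hd : 0 < d) :
    ∃ W ∈ Matrix.unitaryGroup (Fin d) ℂ, ∃ (g : Fin d → ℝ) (z : ℝ),
      gibbs Q β = conjDiag W g ∧ (∀ a, 0 < g a) ∧ ∑ a, g a = 1 ∧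
      ∀ R : Matrix (Fin d) (Fin d) ℂ, (R * cfc Real.log (gibbs Q β)).trace.re =
        -∑ j, β j * (R * Q j).trace.re - z * R.trace.re := by
  obtain ⟨W, hW, h, hh⟩ := exists_eq_conjDiag (isHermitian_neg_sum_smul hQ β)
  have hne : Nonempty (Fin d) := ⟨⟨0, hd⟩⟩
  have hZ : 0 < ∑ a, Real.exp (h a) :=
    Finset.sum_pos (fun _ _ => Real.exp_pos _) Finset.univ_nonempty
  refine ⟨W, hW, _, Real.log (∑ a, Real.exp (h a)), gibbs_eq_conjDiag hW hh,
    fun a => mul_pos (inv_pos.2 hZ) (Real.exp_pos _), ?_, fun R => ?_⟩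
  · rw [← Finset.mul_sum, inv_mul_cancel₀ hZ.ne']
  · rw [gibbs_eq_conjDiag hW hh, cfc_conjDiag hW, trace_mul_conjDiag_re]
    have hlog : ∀ i, Real.log ((∑ a, Real.exp (h a))⁻¹ * Real.exp (h i)) =
        h i - Real.log (∑ a, Real.exp (h a)) := fun i => by
      rw [Real.log_mul (inv_pos.2 hZ).ne' (Real.exp_pos _).ne', Real.log_inv, Real.log_exp]
      ring
    simp only [hlog, mul_sub, Finset.sum_sub_distrib]
    rw [← trace_mul_conjDiag_re, ← hh, ← Finset.sum_mul, sum_diagIn hW, mul_comm R.trace.re, mul_neg,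
      Matrix.trace_neg, Complex.neg_re, Finset.mul_sum, Matrix.trace_sum, Complex.re_sum]
    congr 2
    refine Finset.sum_congr rfl fun j _ => ?_
    rw [Matrix.mul_smul, Matrix.trace_smul, smul_eq_mul, Complex.re_ofReal_mul]

theorem sum_trace_reduced_mul_re (hN : 1 ≤ N) (R : Matrix (Conf d N) (Conf d N) ℂ)
    (A : Matrix (Fin d) (Fin d) ℂ) :
    ∑ l : Fin N, (reduced l R * A).trace.re = N * (R * avgObs N A).trace.re := by
  have hN' : (N : ℂ) ≠ 0 := by exact_mod_cast (Nat.one_le_iff_ne_zero.1 hN)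
  have h : (N : ℂ) * (R * avgObs N A).trace = ∑ l : Fin N, (reduced l R * A).trace := by
    rw [avgObs, Matrix.mul_smul, Matrix.trace_smul, smul_eq_mul, mul_inv_cancel_left₀ hN',
      Finset.mul_sum, Matrix.trace_sum]
    exact Finset.sum_congr rfl fun l _ => (trace_reduced_mul l R A).symm
  rw [← Complex.re_sum, ← h, ← Complex.ofReal_natCast, Complex.re_ofReal_mul]

theorem avgRelEntropy_nonneg {Q : Fin k → Matrix (Fin d) (Fin d) ℂ}
    (hQ : ∀ j, (Q j).IsHermitian) (β : Fin k → ℝ) (hd : 0 < d) {M : Submodule ℂ (Copies d N)}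
    (hM : 0 < (projMatrix M).trace.re) : 0 ≤ avgRelEntropy Q β M := by
  obtain ⟨W, hW, g, _, hγ, hg, hg1, _⟩ := exists_gibbs_spectral hQ β hd
  obtain ⟨U, p, hU, hp, hp0, hp1⟩ := exists_reduced_eq_conjDiag (isState_microState hM)
  refine mul_nonneg (by positivity) (Finset.sum_nonneg fun l _ => ?_)
  rw [hp, hγ]
  exact relEntropy_conjDiag_nonneg (hU l) hW (hp0 l) hg (by rw [hp1, hg1])

/-- The quantitative form of the equivalence of ensembles. Subadditivity of the entropy bounds the
summed relative entropies by `-log (tr P) + N (∑ j, β j * E j + log Z)` with `E j` the mean average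
charges, and the typicality of the product of Gibbs states bounds `-log (tr P)` by
`-N (∑ j, β j * v j + log Z) + O(√N)`. -/
theorem exists_avgRelEntropy_bound {Q : Fin k → Matrix (Fin d) (Fin d) ℂ}
    (hQ : ∀ j, (Q j).IsHermitian) {v β : Fin k → ℝ} (hd : 0 < d)
    (hβ : ∀ j, (gibbs Q β * Q j).trace = (v j : ℂ)) :
    ∃ K A : ℝ, ∀ ε : ℝ, 0 ≤ ε → ε < 1 → ∃ C : ℝ,
      ∀ N : ℕ, 1 ≤ N → ∀ η η' δ δ' : ℝ, 0 ≤ η → 0 ≤ η' → 0 ≤ δ → 0 < δ' →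
        K * Real.log (2 / δ') ≤ N * η' ^ 2 →
        ∀ M : Submodule ℂ (Copies d N), IsApproxMicrocanonical Q v N ε η η' δ δ' M →
          0 < (projMatrix M).trace.re ∧
          avgRelEntropy Q β M ≤ C / √(N : ℝ) + A * (η + δ) := by
  obtain ⟨W, hW, g, z, hγ, hg, hg1, hlog⟩ := exists_gibbs_spectral hQ β hd
  have hγstate : IsState (gibbs Q β) := by
    rw [hγ]
    exact ⟨posSemidef_conjDiag W fun a => (hg a).le, by rw [trace_conjDiag hW, hg1, Complex.ofReal_one]⟩
  choose U hU a ha using fun j => exists_eq_conjDiag (hQ j)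
  have hbound : ∀ (c : ℝ) (x : Fin d → ℝ), ∃ B : ℝ, 0 < B ∧ ∀ i, |x i - c| ≤ B := fun c x => by
    refine ⟨1 + ∑ i, |x i - c|, by positivity, fun i => ?_⟩
    have := Finset.single_le_sum (fun i _ => abs_nonneg (x i - c)) (Finset.mem_univ i)
    linarith
  choose B hB0 hB using fun j => hbound (v j) (a j)
  set S : ℝ := ∑ j, β j * v j + z with hS
  have hSg : ∑ i, g i * Real.log (g i) = -S := by
    have h := hlog (gibbs Q β)
    simp only [hβ, hγstate.2, Complex.ofReal_re, Complex.one_re] at h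
    rw [hγ, cfc_conjDiag hW, trace_mul_conjDiag_re] at h
    simp only [diagIn_conjDiag_self hW] at h
    rw [h, hS]
    ring
  obtain ⟨B', hB'0, hB'⟩ := hbound (-S) fun i => Real.log (g i)
  refine ⟨∑ j, 2 * B j ^ 2, ∑ j, |β j| * (1 + B j), fun ε hε0 hε => ?_⟩
  set L := Real.log (2 / (1 - ε)) with hL
  have hL0 : 0 ≤ L := Real.log_nonneg ((one_le_div (sub_pos.2 hε)).2 (by linarith))
  refine ⟨B' * √(2 * L) + L, fun N hN η η' δ δ' hη hη' hδ hδ' hK M hM => ?_⟩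
  have hN' : (0 : ℝ) < N := by exact_mod_cast hN
  have hVW := tensor_mem_unitaryGroup (N := N) fun _ => hW
  have hG : (tensor fun _ : Fin N => gibbs Q β) = conjDiag (tensor fun _ => W)
      fun f => ∏ l, g (f l) := by
    rw [hγ, tensor_conjDiag]
  have hGstate : IsState (tensor fun _ : Fin N => gibbs Q β) := by
    rw [hG]
    refine ⟨posSemidef_conjDiag _ fun f => Finset.prod_nonneg fun l _ => (hg _).le, ?_⟩
    rw [trace_conjDiag hVW, ← Fintype.prod_sum (fun _ i => g i), hg1, Finset.prod_const_one,
      Complex.ofReal_one]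
  have hoverlap := hM.2 _ hGstate fun j => by
    refine le_trans ?_ (one_sub_le_probNear_tensor (hU j) (ha j) hγstate (hB0 j) (hB j) (hβ j) hN hη')
    have h2B : 0 < 2 * B j ^ 2 := mul_pos two_pos (pow_pos (hB0 j) 2)
    suffices h : 2 * Real.exp (-(N * η' ^ 2 / (2 * B j ^ 2))) ≤ δ' by linarith
    rcases le_total (Real.log (2 / δ')) 0 with h | h
    · have h1 : 2 ≤ δ' := by
        have := (Real.log_nonpos_iff (by positivity)).1 h
        exact (div_le_one hδ').1 this
      have h2 : Real.exp (-(N * η' ^ 2 / (2 * B j ^ 2))) ≤ 1 :=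
        Real.exp_le_one_iff.2 (neg_nonpos.2 (by positivity))
      linarith
    · have h1 : Real.log (2 / δ') ≤ N * η' ^ 2 / (2 * B j ^ 2) := by
        rw [le_div_iff₀ h2B, mul_comm]
        refine le_trans (mul_le_mul_of_nonneg_right ?_ h) hK
        exact Finset.single_le_sum (f := fun j => 2 * B j ^ 2) (fun i _ => by positivity)
          (Finset.mem_univ j)
      have h2 := Real.exp_le_exp.2 (neg_le_neg h1)
      rw [← Real.log_inv, Real.exp_log (by positivity), inv_div] at h2
      linarith
  rw [hG, trace_mul_conjDiag_re] at hoverlap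
  obtain ⟨hpos, hlogr⟩ := neg_log_sum_le hg hg1 hSg hB'0
    (fun i => by simpa only [sub_neg_eq_add] using hB' i) hε0 hε hN
    (fun f => diagIn_nonneg _ (posSemidef_projMatrix M) f) (diagIn_projMatrix_le_one hVW M) hoverlap
  rw [sum_diagIn hVW] at hpos hlogr
  refine ⟨hpos, ?_⟩
  have hΩ := isState_microState hpos
  have hent := sum_trace_mul_log_reduced_le hΩ hpos fun V hV f =>
    trace_mul_diagIn_microState_le_one hpos hV f
  have hmean : ∀ j, β j * (microState M * avgObs N (Q j)).trace.re ≤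
      β j * v j + |β j| * (1 + B j) * (η + δ) := fun j => by
    have h1 := abs_trace_mul_avgObs_sub_le (hU j) (ha j) hΩ (hB j) (hB0 j).le hN hη
      (hM.1 _ hΩ (range_microState_le M) j)
    have h2 : β j * ((microState M * avgObs N (Q j)).trace.re - v j) ≤ |β j| * (η + B j * δ) :=
      (le_abs_self _).trans (by rw [abs_mul]; gcongr)
    have h3 : |β j| * (η + B j * δ) ≤ |β j| * ((1 + B j) * (η + δ)) := by
      refine mul_le_mul_of_nonneg_left ?_ (abs_nonneg _)
      have := mul_nonneg (hB0 j).le hη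
      linarith
    linarith
  have hsum : ∑ l, relEntropy (reduced l (microState M)) (gibbs Q β) =
      ∑ l, (reduced l (microState M) * cfc Real.log (reduced l (microState M))).trace.re +
        N * (∑ j, β j * (microState M * avgObs N (Q j)).trace.re + z) := by
    have h : ∀ l, relEntropy (reduced l (microState M)) (gibbs Q β) =
        (reduced l (microState M) * cfc Real.log (reduced l (microState M))).trace.re +
        (∑ j, β j * (reduced l (microState M) * Q j).trace.re + z) := fun l => by
      rw [relEntropy, mul_sub, Matrix.trace_sub, Complex.sub_re, hlog, trace_reduced, hΩ.2,
        Complex.one_re]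
      ring
    rw [Finset.sum_congr rfl fun l _ => h l, Finset.sum_add_distrib, Finset.sum_add_distrib,
      Finset.sum_comm, Finset.sum_const, Finset.card_univ, Fintype.card_fin, nsmul_eq_mul, mul_add,
      Finset.mul_sum]
    congr 2
    refine Finset.sum_congr rfl fun j _ => ?_
    rw [← Finset.mul_sum, sum_trace_reduced_mul_re hN]
    ring
  have hmean' := Finset.sum_le_sum fun j (_ : j ∈ Finset.univ) => hmean j
  rw [Finset.sum_add_distrib, ← Finset.sum_mul] at hmean'
  have htotal : ∑ l, relEntropy (reduced l (microState M)) (gibbs Q β) ≤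
      √N * (B' * √(2 * L)) + L + N * ((∑ j, |β j| * (1 + B j)) * (η + δ)) := by
    have h1 := mul_le_mul_of_nonneg_left hmean' hN'.le
    rw [hsum]
    rw [hS] at hlogr
    linarith
  have hsq := Real.mul_self_sqrt hN'.le
  have hs0 : 0 < √(N : ℝ) := Real.sqrt_pos.2 hN'
  have hs1 : 1 ≤ √(N : ℝ) := Real.one_le_sqrt.2 (by exact_mod_cast hN)
  rw [avgRelEntropy, one_div, inv_mul_le_iff₀ hN']
  refine htotal.trans ?_
  have h1 : (N : ℝ) * ((B' * √(2 * L) + L) / √N) = √N * (B' * √(2 * L)) + √N * L := by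
    rw [← mul_div_assoc, div_eq_iff hs0.ne']
    linear_combination -(B' * √(2 * L) + L) * hsq
  have h2 := mul_le_mul_of_nonneg_right hs1 hL0
  rw [mul_add (N : ℝ), h1]
  linarith

end RelativeEntropy
end Microcanonical

end

theorem mainTheorem3 {d k : ℕ} (Q : Fin k → Matrix (Fin d) (Fin d) ℂ)
    (hQ : ∀ j, (Q j).IsHermitian) (v : Fin k → ℝ)
    (hv : ∃ R : Matrix (Fin d) (Fin d) ℂ, R.PosDef ∧ R.trace = 1 ∧
      ∀ j, (R * Q j).trace = (v j : ℂ)) :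
    ∃ β : Fin k → ℝ,
      (∀ j, (Microcanonical.gibbs Q β * Q j).trace = (v j : ℂ)) ∧
      ∃ K A : ℝ,
        (∀ ε : ℝ, 0 ≤ ε → ε < 1 → ∃ C : ℝ,
          ∀ N : ℕ, 1 ≤ N → ∀ η η' δ δ' : ℝ, 0 ≤ η → 0 ≤ η' → 0 ≤ δ → 0 < δ' →
            K * Real.log (2 / δ') ≤ N * η' ^ 2 →
            ∀ M : Submodule ℂ (Microcanonical.Copies d N),
              Microcanonical.IsApproxMicrocanonical Q v N ε η η' δ δ' M →
              M ≠ ⊥ ∧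
              Microcanonical.avgRelEntropy Q β M ≤ C / √(N : ℝ) + A * (η + δ)) ∧
        (∀ (ε η η' δ δ' : ℕ → ℝ) (M : ∀ N : ℕ, Submodule ℂ (Microcanonical.Copies d N)) (ε₀ : ℝ),
          ε₀ < 1 →
          (∀ᶠ N in atTop, 0 ≤ ε N ∧ ε N ≤ ε₀ ∧ 0 ≤ η N ∧ 0 ≤ η' N ∧ 0 ≤ δ N ∧ 0 < δ' N ∧
            K * Real.log (2 / δ' N) ≤ N * η' N ^ 2 ∧
            Microcanonical.IsApproxMicrocanonical Q v N (ε N) (η N) (η' N) (δ N) (δ' N) (M N)) →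
          (η =O[atTop] fun N : ℕ => 1 / √(N : ℝ)) →
          (δ =O[atTop] fun N : ℕ => 1 / √(N : ℝ)) →
          (fun N : ℕ => Microcanonical.avgRelEntropy Q β (M N))
            =O[atTop] fun N : ℕ => 1 / √(N : ℝ)) := by
  have hd : 0 < d := by
    obtain ⟨R, -, htr, -⟩ := hv
    rcases Nat.eq_zero_or_pos d with rfl | h
    · simp [Matrix.trace] at htr
    · exact h
  obtain ⟨β, hβ⟩ := Microcanonical.exists_gibbs hQ hv
  obtain ⟨K, A, hKA⟩ := Microcanonical.exists_avgRelEntropy_bound hQ hd hβ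
  refine ⟨β, hβ, K, A, fun ε hε0 hε => ?_, fun ε η η' δ δ' M ε₀ hε₀ hM hη hδ => ?_⟩
  · obtain ⟨C, hC⟩ := hKA ε hε0 hε
    refine ⟨C, fun N hN η η' δ δ' h1 h2 h3 h4 h5 M hM => ?_⟩
    obtain ⟨hpos, hle⟩ := hC N hN η η' δ δ' h1 h2 h3 h4 h5 M hM
    exact ⟨Microcanonical.ne_bot_of_trace_projMatrix_pos hpos, hle⟩
  · obtain ⟨C, hC⟩ := hKA (max ε₀ 0) (le_max_right _ _) (max_lt hε₀ one_pos)
    have hbound : (fun N : ℕ => C / √(N : ℝ) + A * (η N + δ N))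
        =O[atTop] fun N : ℕ => 1 / √(N : ℝ) := by
      refine IsBigO.add ?_ ((hη.add hδ).const_mul_left A)
      simp only [div_eq_mul_one_div C]
      exact (isBigO_refl _ _).const_mul_left C
    refine IsBigO.trans (IsBigO.of_bound 1 ?_) hbound
    filter_upwards [hM, eventually_ge_atTop 1] with N ⟨_, h1, h2, h3, h4, h5, h6, h7⟩ hN
    obtain ⟨hpos, hle⟩ := hC N hN _ _ _ _ h2 h3 h4 h5 h6 (M N)
      ⟨h7.1, fun R hR hprob => le_trans (by linarith [h1.trans (le_max_left ε₀ 0)])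
        (h7.2 R hR hprob)⟩
    rw [one_mul, Real.norm_of_nonneg (Microcanonical.avgRelEntropy_nonneg hQ β hd hpos)]
    exact hle.trans (Real.le_norm_self _)
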